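/- **Formulas.** Let formulas of first-order real arithmetic be generated by $$F,G ::= \top \mid \bot \mid p<0 \mid p=0 \mid p\le 0 \mid p\neq 0 \mid F\wedge G \mid F\vee G \mid \neg F \mid \exists F \mid \forall F \mid \exists^n F \mid \forall^n F,$$ with $p\in\mathbb R[X_0,X_1,\dots]$ and $n\in\mathbb N$; variables are de Bruijn indices, so $X_0$ is bound by the innermost quantifier. A valuation is a finite list $\nu$ of reals; a polynomial is evaluated by substituting the $i$-th entry of $\nu$ (counting from $0$) for $X_i$, and $0$ for the variables not covered by $\nu$. The truth value $\mathrm{eval}(F,\nu)$ is the usual one, with $\mathrm{eval}(\forall F,\nu)$ meaning $\mathrm{eval}(F,x\#\nu)$ for all $x\in\mathbb R$ (where $x\#\nu$ is $\nu$ with $x$ prepended), $\mathrm{eval}(\forall^nF,\nu)$ meaning that $F$ is true at every list obtained by prepending $n$ reals to $\nu$, and likewise for $\exists,\exists^n$. **The procedure.** $\mathrm{qe}$ commutes with $\wedge,\vee,\neg$, leaves atoms, $\top$ and $\bot$ unchanged, and $\mathrm{qe}(\forall F)=A(\mathrm{qe}(F))$, $\mathrm{qe}(\exists F)=E(\mathrm{qe}(F))$,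 $\mathrm{qe}(\forall^nF)=A^n(\mathrm{qe}(F))$, $\mathrm{qe}(\exists^nF)=E^n(\mathrm{qe}(F))$, where $E(F)=\neg A(\neg F)$ and $A$ is the following elimination of one universal quantifier from a quantifier-free $F$. 1. List the polynomials $q_1,\dots,q_k$ of $F$, view them as polynomials in $x=X_0$, and lower all variable indices in their coefficients by one. 2. Branch on all sign assumptions ($+,0,-$) on leading coefficients of the $q_i$ in $x$; a leading coefficient that is assumed to be $0$ is dropped and the next one is treated in the same way. A sign that is already assumed in the branch is reused, here and below. From now on $q_i$ denotes the simplified polynomial of the branch. 3. In each branch let $f$ be the product of the $q_i$ that are not identically zero and $p=f\cdot\partial f/\partial x$. Find the sign assignments of $(q_1,\dots,q_k)$ at the roots of $p$ by the matrix equation $Mw=v$, whose columns are possible sign assignments $\sigma_j$, whose rows are pairs $(I_i,J_i)$ of subsets of $\{1,\dots,k\}$, with $M_{ij}=\prod_{\ell\in I_i}(1-\sigma_j(q_\ell)^2)\prod_{\ell\in J_i}\sigma_j(q_\ell)$, and with $v_i$ the Tarski query $N\big(p^2+\sum_{\ell\in I_i}q_\ell^2,\ \prod_{\ell\in J_i}q_\ell\big)$.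 Here $N(g,h)=S^--S^+$, where $S^+$ is the number of sign changes in the leading coefficients $a_1,a_2,\dots$ of the signed pseudo-remainder sequence $g_1=g$, $g_2=g'h$, $g_{i+2}=s_i\,\mathrm{prem}(g_i,g_{i+1})$, and $S^-$ is that in $(-1)^{\deg g_1}a_1,(-1)^{\deg g_2}a_2,\dots$; $s_i=-1$ if $1+\deg g_i-\deg g_{i+1}$ (taken as $0$ when negative) is even, and $s_i$ is minus the leading coefficient of $g_{i+1}$ otherwise; the signs of the leading coefficients are again obtained by branching on sign assumptions; $N=0$ if $g$ is zero in the branch. For one polynomial the rows are $(\emptyset,\emptyset),(\{1\},\emptyset),(\emptyset,\{1\})$ and the columns $+,0,-$; for no polynomial there is the single row $(\emptyset,\emptyset)$ and the single (empty) column. A list of two or more polynomials is split into two halves, and the matrix equations of the halves are combined (Kronecker product), for each pair of branches. Every matrix equation is reduced: one solves $w=M^{-1}v$, deletes the columns with $w_j=0$, and keeps only the rows of the remaining matrix that are not linear combinations of earlier rows. 4. To the sign assignments found in each refined branch add those at $+\infty$ and $-\infty$, read off from the assumed signs of the leading coefficients and the degrees of the $q_i$. 5. $A(F)$ is the disjunction,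 over all refined branches in which every listed sign assignment makes $F$ true, of the conjunction of the sign assumptions of the branch, each written as $c=0$, $c<0$ or $-c<0$. **Theorem.** For every formula $F$ and every valuation $\nu$, $\mathrm{eval}(F,\nu)$ holds if and only if $\mathrm{eval}(\mathrm{qe}(F),\nu)$ holds; that is, $\mathrm{qe}(F)$ is logically equivalent to $F$. -/

import Mathlib

noncomputable section

namespace HybridQE

open Polynomial

/-! ### Formulas of first-order real arithmetic and their semantics -/

/-- Real multivariate polynomials; the variable `X i` is the de Bruijn variable `Var i`. -/
abbrev RealMPoly : Type := MvPolynomial ℕ ℝ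

/-- Univariate polynomials whose coefficients are real multivariate polynomials. -/
abbrev RMPoly : Type := Polynomial RealMPoly

/-- The atoms `p < 0`, `p = 0`, `p ≤ 0`, `p ≠ 0`. -/
inductive Atom : Type where
  | less (p : RealMPoly)
  | eq (p : RealMPoly)
  | leq (p : RealMPoly)
  | neq (p : RealMPoly)

/-- Formulas over atoms in `α`. Quantifiers bind by de Bruijn indices; `exN n F` and `allN n F`
are blocks of `n` quantifiers. -/
inductive Fm (α : Type) : Type where
  | trueF : Fm α
  | falseF : Fm α
  | atom (a : α) : Fm α
  | and (F G : Fm α) : Fm α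
  | or (F G : Fm α) : Fm α
  | neg (F : Fm α) : Fm α
  | exQ (F : Fm α) : Fm α
  | allQ (F : Fm α) : Fm α
  | exN (n : ℕ) (F : Fm α) : Fm α
  | allN (n : ℕ) (F : Fm α) : Fm α

/-- Evaluation of a polynomial at a list of reals: the entry at position `i` is substituted for
`Var i`, and `0` is substituted for the variables that the list does not cover. -/
def evalMPoly (ν : List ℝ) (p : RealMPoly) : ℝ :=
  MvPolynomial.eval (fun i => ν.getD i 0) p

/-- Truth value of an atom. -/
def aEval : Atom → List ℝ → Prop
  | .less p, ν => evalMPoly ν p < 0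
  | .eq p, ν => evalMPoly ν p = 0
  | .leq p, ν => evalMPoly ν p ≤ 0
  | .neq p, ν => evalMPoly ν p ≠ 0

/-- Truth value of a formula. -/
def eval : Fm Atom → List ℝ → Prop
  | .trueF, _ => True
  | .falseF, _ => False
  | .atom a, ν => aEval a ν
  | .and F G, ν => eval F ν ∧ eval G ν
  | .or F G, ν => eval F ν ∨ eval G ν
  | .neg F, ν => ¬ eval F ν
  | .exQ F, ν => ∃ x : ℝ, eval F (x :: ν)
  | .allQ F, ν => ∀ x : ℝ, eval F (x :: ν)
  | .exN n F, ν => ∃ L : List ℝ, L.length = n ∧ eval F (L ++ ν)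
  | .allN n F, ν => ∀ L : List ℝ, L.length = n → eval F (L ++ ν)

/-! ### Sign assumptions -/

/-- Lists of sign assumptions: `(c, s)` assumes that `c` has the sign `s ∈ {-1, 0, 1}`. -/
abbrev Assumps : Type := List (RealMPoly × ℚ)

open scoped Classical in
/-- The first sign that is recorded for `c` in the list, if there is one. -/
def lookupSign (c : RealMPoly) : Assumps → Option ℚ
  | [] => none
  | (c', s) :: t => if c = c' then some s else lookupSign c t

/-! ### Pseudo-remainder sequences with branching -/

/-- `k` steps of pseudo-division by `q`. -/
def pseudoModAux (q : RMPoly) : ℕ → RMPoly → RMPoly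
  | 0, r => r
  | k + 1, r => pseudoModAux q k
      (C q.leadingCoeff * r - C (r.coeff (k + q.natDegree)) * X ^ k * q)

/-- The pseudo-remainder `prem(p, q)`, with
`lc(q) ^ (1 + deg p - deg q) * p = pquo(p, q) * q + prem(p, q)` and `deg prem(p, q) < deg q`
(and `prem(p, q) = p` if `deg p < deg q`). -/
def pseudoMod (p q : RMPoly) : RMPoly :=
  pseudoModAux q (p.natDegree + 1 - q.natDegree) p

/-- The signed pseudo-remainder: `prem(p, q)` multiplied by `-1` if `1 + deg p - deg q` is even,
and by `-lc(q)` otherwise. -/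
def mulPseudoMod (p q : RMPoly) : RMPoly :=
  C (if Even (p.natDegree + 1 - q.natDegree) then -1 else -q.leadingCoeff) * pseudoMod p q

theorem degree_pseudoModAux_lt (q : RMPoly) (hq : q ≠ 0) :
    ∀ (k : ℕ) (r : RMPoly), r.degree < ((k + q.natDegree : ℕ) : WithBot ℕ) →
      (pseudoModAux q k r).degree < q.degree := by
  intro k
  induction k with
  | zero =>
    intro r hr
    rw [degree_eq_natDegree hq]
    simpa [pseudoModAux] using hr
  | succ k ih =>
    intro r hr
    apply ih
    rw [degree_lt_iff_coeff_zero] at hr ⊢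
    intro m hm
    rw [coeff_sub, coeff_C_mul, mul_assoc, coeff_C_mul, coeff_X_pow_mul', if_pos (by omega)]
    rcases Nat.eq_or_lt_of_le hm with h | h
    · have : m - k = q.natDegree := by omega
      rw [this, ← h, coeff_natDegree, mul_comm, sub_self]
    · rw [hr m (by omega), coeff_eq_zero_of_natDegree_lt (by omega : q.natDegree < m - k)]
      simp

theorem degree_mulPseudoMod_lt (p q : RMPoly) (hq : q ≠ 0) :
    (mulPseudoMod p q).degree < q.degree := by
  have h : (mulPseudoMod p q).degree ≤ (pseudoMod p q).degree := by
    unfold mulPseudoMod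
    rw [← smul_eq_C_mul]
    exact degree_smul_le _ _
  refine lt_of_le_of_lt h (degree_pseudoModAux_lt q hq _ p ?_)
  refine lt_of_le_of_lt degree_le_natDegree ?_
  exact_mod_cast (by omega : p.natDegree < p.natDegree + 1 - q.natDegree + q.natDegree)

open scoped Classical in
/-- Signed pseudo-remainder sequences of `p` and `q`, one for each branch of sign assumptions on
the leading coefficients that are met. The leading coefficient of `p` is assumed to be nonzero in
the given branch. If the leading coefficient of `q` is assumed to vanish, then the leading
monomial of `q` is dropped (`eraseLead`). -/
def spmodsAux (p q : RMPoly) (a : Assumps) : List (Assumps × List RMPoly) :=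
  if hq : q = 0 then [(a, [p])]
  else
    match lookupSign q.leadingCoeff a with
    | none =>
        spmodsAux p q.eraseLead ((q.leadingCoeff, 0) :: a) ++
        (spmodsAux q (mulPseudoMod p q) ((q.leadingCoeff, 1) :: a)).map
          (fun b => (b.1, p :: b.2)) ++
        (spmodsAux q (mulPseudoMod p q) ((q.leadingCoeff, -1) :: a)).map
          (fun b => (b.1, p :: b.2))
    | some s =>
        if s = 0 then spmodsAux p q.eraseLead a
        else (spmodsAux q (mulPseudoMod p q) a).map (fun b => (b.1, p :: b.2))
termination_by q.degree
decreasing_by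
  all_goals first
    | exact degree_eraseLead_lt hq
    | exact degree_mulPseudoMod_lt _ _ hq

open scoped Classical in
/-- Signed pseudo-remainder sequences of `p` and `q` in all branches, where the true leading
coefficient of `p` is determined by branching as well. -/
def spmods (p q : RMPoly) (a : Assumps) : List (Assumps × List RMPoly) :=
  if hp : p = 0 then [(a, [])]
  else
    match lookupSign p.leadingCoeff a with
    | none =>
        spmods p.eraseLead q ((p.leadingCoeff, 0) :: a) ++
        spmodsAux p q ((p.leadingCoeff, 1) :: a) ++
        spmodsAux p q ((p.leadingCoeff, -1) :: a)
    | some s => if s = 0 then spmods p.eraseLead q a else spmodsAux p q a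
termination_by p.degree
decreasing_by
  all_goals exact degree_eraseLead_lt hp

/-! ### Multivariate Tarski queries -/

/-- Number of adjacent pairs of opposite sign. -/
def adjacentChanges : List ℚ → ℕ
  | s :: t :: l => (if s * t < 0 then 1 else 0) + adjacentChanges (t :: l)
  | _ => 0

/-- Number of sign changes in a list, where zeros are ignored. -/
def signChanges (l : List ℚ) : ℕ := adjacentChanges (l.filter (fun s => s ≠ 0))

/-- The number `S⁻ - S⁺` of a remainder sequence, computed from the degrees of its members and
the signs of their leading coefficients that are recorded in the assumptions. -/
def tarskiOfSeq (a : Assumps) (ps : List RMPoly) : ℚ :=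
  (signChanges (ps.map fun p => (-1) ^ p.natDegree * (lookupSign p.leadingCoeff a).getD 0) : ℚ) -
    (signChanges (ps.map fun p => (lookupSign p.leadingCoeff a).getD 0) : ℚ)

/-- The Tarski queries `N(p² + ∑ q_i², ∏ q_j)` (`q_i` in the list `I`, `q_j` in the list `J`)
together with the branches of assumptions that they are subject to. -/
def tarskiQueries (p : RMPoly) (a : Assumps) (I J : List RMPoly) : List (Assumps × ℚ) :=
  let f := p ^ 2 + (I.map (fun q => q ^ 2)).sum
  (spmods f (derivative f * J.prod) a).map (fun b => (b.1, tarskiOfSeq b.1 b.2))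

/-! ### The multivariate matrix equation -/

/-- A matrix equation, given by its list of pairs `(I, J)` of index sets (the rows) and its list
of possible sign assignments (the columns). -/
structure MatrixEq : Type where
  subsets : List (List ℕ × List ℕ)
  signs : List (List ℚ)

/-- The matrix with entries `∏_{ℓ ∈ I_i} (1 - σ_j(q_ℓ)²) * ∏_{ℓ ∈ J_i} σ_j(q_ℓ)`. -/
def signMatrix (S : List (List ℕ × List ℕ)) (T : List (List ℚ)) :
    Matrix (Fin S.length) (Fin T.length) ℚ :=
  Matrix.of fun i j =>
    ((S.get i).1.map fun l => 1 - (T.get j).getD l 0 ^ 2).prod *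
      ((S.get i).2.map fun l => (T.get j).getD l 0).prod

/-- The right-hand sides `(N(I_i, J_i))_i`, with the branches of assumptions that they are
subject to; the assumptions accumulate along the list of rows. -/
def rhsVectors (p : RMPoly) (qs : List RMPoly) :
    List (List ℕ × List ℕ) → Assumps → List (Assumps × List ℚ)
  | [], a => [(a, [])]
  | (I, J) :: S, a =>
      (tarskiQueries p a (I.map fun l => qs.getD l 0) (J.map fun l => qs.getD l 0)).flatMap
        fun b => (rhsVectors p qs S b.1).map fun c => (c.1, b.2 :: c.2)

/-- The solution `w = M⁻¹ v` of the matrix equation `M w = v`, where `M` is square. -/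
def MatrixEq.solve (E : MatrixEq) (v : List ℚ) : Fin E.signs.length → ℚ :=
  if h : E.signs.length = E.subsets.length then
    ((signMatrix E.subsets E.signs).submatrix (Fin.cast h) id)⁻¹.mulVec (fun i => v.getD i 0)
  else 0

open scoped Classical in
/-- The reduction step: keep only the sign assignments `σ_j` with `w_j ≠ 0`, and keep only those
rows of the remaining matrix that are not linear combinations of earlier rows (that is, the
pivot positions in the row reduction of the transposed matrix). -/
def MatrixEq.reduce (E : MatrixEq) (w : Fin E.signs.length → ℚ) : MatrixEq :=
  let T := ((List.finRange E.signs.length).filter (fun j => w j ≠ 0)).map E.signs.get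
  let M := signMatrix E.subsets T
  { subsets := ((List.finRange E.subsets.length).filter
      (fun i => M.row i ∉ Submodule.span ℚ (M.row '' {k | k < i}))).map E.subsets.get
    signs := T }

/-- Solve a matrix equation for `p` and `qs` in every branch and reduce it. -/
def reduceSystem (p : RMPoly) (qs : List RMPoly) (a : Assumps) (E : MatrixEq) :
    List (Assumps × MatrixEq) :=
  (rhsVectors p qs E.subsets a).map fun b => (b.1, E.reduce (E.solve b.2))

/-- The matrix equation for no polynomial: `M = (1)`, and the right-hand side counts the roots
of `p`. -/
def emptyCase : MatrixEq where
  subsets := [([], [])]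
  signs := [[]]

/-- The matrix equation for a single polynomial: all three signs are possible. -/
def baseCase : MatrixEq where
  subsets := [([], []), ([0], []), ([], [0])]
  signs := [[1], [0], [-1]]

/-- Combination of a matrix equation for `n` polynomials with one for further polynomials; its
matrix is the Kronecker product of the two matrices. -/
def combine (n : ℕ) (E₁ E₂ : MatrixEq) : MatrixEq where
  subsets := E₁.subsets.flatMap fun s => E₂.subsets.map fun t =>
    (s.1 ++ t.1.map (fun l => l + n), s.2 ++ t.2.map (fun l => l + n))
  signs := E₁.signs.flatMap fun s => E₂.signs.map fun t => s ++ t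

/-- The matrix equations for the signs of `qs` at the roots of `p`, in branches of assumptions
that extend `a`: the list `qs` is halved, and the reduced matrix equations for the two halves are
combined and reduced again. -/
def calculateData (p : RMPoly) (qs : List RMPoly) (a : Assumps) : List (Assumps × MatrixEq) :=
  if h : qs.length ≤ 1 then
    reduceSystem p qs a (if qs.length = 0 then emptyCase else baseCase)
  else
    let n := qs.length / 2
    let left := calculateData p (qs.take n) a
    let right := calculateData p (qs.drop n) a
    left.flatMap fun b => right.flatMap fun c =>
      reduceSystem p qs (b.1 ++ c.1) (combine n b.2 c.2)
termination_by qs.length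
decreasing_by
  all_goals simp only [List.length_take, List.length_drop]
  all_goals omega

/-! ### Sign determination -/

open scoped Classical in
/-- Branching on the sign of the leading coefficient of `q`. Each branch carries the simplified
polynomial, whose leading coefficient is assumed to be nonzero, or which is zero. -/
def lcAssumps (q : RMPoly) (a : Assumps) : List (Assumps × RMPoly) :=
  if hq : q = 0 then [(a, 0)]
  else
    match lookupSign q.leadingCoeff a with
    | none =>
        ((q.leadingCoeff, 1) :: a, q) :: ((q.leadingCoeff, -1) :: a, q) ::
          lcAssumps q.eraseLead ((q.leadingCoeff, 0) :: a)
    | some s => if s = 0 then lcAssumps q.eraseLead a else [(a, q)]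
termination_by q.degree
decreasing_by
  all_goals exact degree_eraseLead_lt hq

/-- Branching on the signs of the leading coefficients of all polynomials of a list. -/
def lcAssumpsList : List RMPoly → Assumps → List (Assumps × List RMPoly)
  | [], a => [(a, [])]
  | q :: qs, a =>
      (lcAssumps q a).flatMap fun b => (lcAssumpsList qs b.1).map fun c => (c.1, b.2 :: c.2)

open scoped Classical in
/-- `p = (∏ q_i) * ∂/∂x (∏ q_i)`, where the product is over the `q_i` that are not identically
zero in the branch. -/
def polyP (qs : List RMPoly) : RMPoly :=
  let f := (qs.filter (fun q => q ≠ 0)).prod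
  f * derivative f

open scoped Classical in
/-- Signs of the (simplified) polynomials at `+∞`: the signs of the leading coefficients. -/
def posLimit (a : Assumps) (qs : List RMPoly) : List ℚ :=
  qs.map fun q => (if q = 0 then 0 else (lookupSign q.leadingCoeff a).getD 0)

open scoped Classical in
/-- Signs of the (simplified) polynomials at `-∞`. -/
def negLimit (a : Assumps) (qs : List RMPoly) : List ℚ :=
  qs.map fun q =>
    (if q = 0 then 0 else (-1) ^ q.natDegree * (lookupSign q.leadingCoeff a).getD 0)

/-- Sign determination: branches of assumptions, each with its list of sign assignments to `qs`,
namely those at `+∞`, at `-∞` and at the roots of `polyP`. -/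
def signDetermination (qs : List RMPoly) (a : Assumps) : List (Assumps × List (List ℚ)) :=
  (lcAssumpsList qs a).flatMap fun b =>
    (calculateData (polyP b.2) b.2 b.1).map fun c =>
      (c.1, posLimit b.1 b.2 :: negLimit b.1 b.2 :: c.2.signs)

/-! ### Quantifier elimination -/

/-- The polynomial of an atom. -/
def Atom.poly : Atom → RealMPoly
  | .less p => p
  | .eq p => p
  | .leq p => p
  | .neq p => p

/-- The list of the polynomials of a formula. -/
def extractPolys : Fm Atom → List RealMPoly
  | .trueF => []
  | .falseF => []
  | .atom a => [a.poly]
  | .and F G => extractPolys F ++ extractPolys G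
  | .or F G => extractPolys F ++ extractPolys G
  | .neg F => extractPolys F
  | .exQ F => extractPolys F
  | .allQ F => extractPolys F
  | .exN _ F => extractPolys F
  | .allN _ F => extractPolys F

/-- A multivariate polynomial, viewed as a univariate polynomial in `Var x` whose coefficients
are polynomials in the other variables. -/
def univariateIn (x : ℕ) (p : RealMPoly) : RMPoly :=
  MvPolynomial.aeval (fun i => if i = x then (X : RMPoly) else C (MvPolynomial.X i)) p

/-- Lowering all variable indices by `1` (for polynomials in which `Var 0` does not occur). -/
def lowerPoly : RealMPoly →ₐ[ℝ] RealMPoly := MvPolynomial.rename (fun i => i - 1)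

/-- Truth value of an atom, given the sign of its polynomial. -/
def Atom.holdsAt : Atom → ℚ → Prop
  | .less _, s => s < 0
  | .eq _, s => s = 0
  | .leq _, s => s ≤ 0
  | .neq _, s => s ≠ 0

/-- Truth value of a quantifier-free formula, given a list of signs of polynomials; `none` if
the formula has a quantifier or a polynomial whose sign is not in the list. -/
def lookupSem : Fm Atom → List (RealMPoly × ℚ) → Option Prop
  | .trueF, _ => some True
  | .falseF, _ => some False
  | .atom a, l => (lookupSign a.poly l).map a.holdsAt
  | .and F G, l => (lookupSem F l).bind fun P => (lookupSem G l).map fun Q => P ∧ Q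
  | .or F G, l => (lookupSem F l).bind fun P => (lookupSem G l).map fun Q => P ∨ Q
  | .neg F, l => (lookupSem F l).map fun P => ¬ P
  | .exQ _, _ => none
  | .allQ _, _ => none
  | .exN _ _, _ => none
  | .allN _ _, _ => none

/-- The atom that expresses a sign assumption. -/
def assumpToAtom (b : RealMPoly × ℚ) : Atom :=
  if b.2 = 0 then .eq b.1 else if b.2 < 0 then .less b.1 else .less (-b.1)

/-- The conjunction of a list of sign assumptions. -/
def assumpsToFm : Assumps → Fm Atom
  | [] => .trueF
  | b :: t => .and (.atom (assumpToAtom b)) (assumpsToFm t)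

/-- The disjunction of a list of branches. -/
def disjunction : List Assumps → Fm Atom
  | [] => .falseF
  | a :: t => .or (assumpsToFm a) (disjunction t)

open scoped Classical in
/-- Elimination of the universal quantifier in `∀ Var 0, F`, for quantifier-free `F`: the
disjunction of all branches in which every sign assignment satisfies `F`. -/
def elimForall (F : Fm Atom) : Fm Atom :=
  let qs := extractPolys F
  let univQs := qs.map (univariateIn 0)
  let reindexedUnivQs := univQs.map (Polynomial.map lowerPoly.toRingHom)
  let data := signDetermination reindexedUnivQs []
  disjunction ((data.filter fun b =>
    ∀ s ∈ b.2, ∃ P : Prop, lookupSem F (qs.zip s) = some P ∧ P).map Prod.fst)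

/-- Elimination of the existential quantifier in `∃ Var 0, F`, for quantifier-free `F`. -/
def elimExist (F : Fm Atom) : Fm Atom := .neg (elimForall (.neg F))

/-- The quantifier elimination procedure: quantifiers are eliminated from the inside out. -/
def qe : Fm Atom → Fm Atom
  | .trueF => .trueF
  | .falseF => .falseF
  | .atom a => .atom a
  | .and F G => .and (qe F) (qe G)
  | .or F G => .or (qe F) (qe G)
  | .neg F => .neg (qe F)
  | .exQ F => elimExist (qe F)
  | .allQ F => elimForall (qe F)
  | .exN n F => elimExist^[n] (qe F)
  | .allN n F => elimForall^[n] (qe F)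

end HybridQE

end

/-!
Everything rests on one invariant: of the branches that the procedure produces, at least one has
sign assumptions which hold at the given valuation `ν`, and in each such branch the computed data
are correct for the univariate polynomials obtained by evaluating the coefficients at `ν`.

Sturm–Tarski: the Tarski query, the sum of `sgn (h x)` over the roots `x` of `g`, is the Cauchy
index of `g' h / g`, because `g' / g` has a simple pole with positive residue at each root of `g`.
A Euclidean division step changes a Cauchy index by a quantity that depends only on signs at `±∞`,
so the index can be read off from the sign changes of the signed remainder sequence there.
Multiplying a remainder by a positive number is harmless, which is why pseudo-division with sign
correction suffices.

By the Tarski queries, `M w = v` is solved by the numbers of roots of `p` at which each sign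
assignment occurs. As `M` is invertible, the assignments with nonzero weight are exactly those
that occur at the roots.

With `f` the product of the nonzero `q_i`, every sign assignment to the `q_i` occurs at a root of
`f`, at a root of `f'` between two adjacent roots of `f` (Rolle), or at `±∞`.
-/

noncomputable section

namespace HybridQE

open Polynomial

/-! ### Powers of a linear factor -/

theorem exists_eq_pow_mul {R : Type*} [CommRing R] {p : R[X]} (hp : p ≠ 0) (a : R) :
    ∃ (m : ℕ) (u : R[X]), u.eval a ≠ 0 ∧ p = (X - C a) ^ m * u :=
  ⟨_, _, eval_divByMonic_pow_rootMultiplicity_ne_zero a hp,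
    (pow_mul_divByMonic_rootMultiplicity_eq p a).symm⟩

theorem rootMultiplicity_pow_mul {R : Type*} [CommRing R] [IsDomain R] {u : R[X]} {a : R}
    (hu : u.eval a ≠ 0) (m : ℕ) : ((X - C a) ^ m * u).rootMultiplicity a = m := by
  have hu0 : u ≠ 0 := by rintro rfl; simp at hu
  rw [mul_comm, rootMultiplicity_mul_X_sub_C_pow hu0, rootMultiplicity_eq_zero hu, zero_add]

theorem derivative_pow_succ_mul {R : Type*} [CommRing R] (u : R[X]) (a : R) (m : ℕ) :
    derivative ((X - C a) ^ (m + 1) * u) =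
      (X - C a) ^ m * (C ((m : R) + 1) * u + (X - C a) * derivative u) := by
  rw [derivative_mul, derivative_X_sub_C_pow, Nat.add_sub_cancel, Nat.cast_succ]
  ring

/-! ### Signs -/

section OrderedRing

variable {R : Type*} [CommRing R] [LinearOrder R] [IsStrictOrderedRing R]

/-- The sign of an element of an ordered ring as a rational number, in the encoding of sign
assumptions. It is bundled as a homomorphism because products of signs occur throughout. -/
def sgn : R →*₀ ℚ := SignType.castHom.comp signHom

theorem sgn_eq_cast_sign (x : R) : sgn x = (SignType.sign x : ℚ) := rfl

theorem sgn_of_pos {x : R} (hx : 0 < x) : sgn x = 1 := by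
  simp [sgn_eq_cast_sign, sign_pos hx]

theorem sgn_of_neg {x : R} (hx : x < 0) : sgn x = -1 := by
  simp [sgn_eq_cast_sign, sign_neg hx]

theorem sgn_eq_zero_iff {x : R} : sgn x = 0 ↔ x = 0 := by
  rcases lt_trichotomy x 0 with hx | rfl | hx
  · simp [sgn_of_neg hx, hx.ne]
  · simp
  · simp [sgn_of_pos hx, hx.ne']

theorem sgn_cases (x : R) :
    (x < 0 ∧ sgn x = -1) ∨ (x = 0 ∧ sgn x = 0) ∨ (0 < x ∧ sgn x = 1) := by
  rcases lt_trichotomy x 0 with hx | rfl | hx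
  · exact .inl ⟨hx, sgn_of_neg hx⟩
  · exact .inr (.inl ⟨rfl, map_zero sgn⟩)
  · exact .inr (.inr ⟨hx, sgn_of_pos hx⟩)

theorem sgn_neg_one : sgn (-1 : R) = -1 := sgn_of_neg neg_one_lt_zero

theorem sgn_sq_of_ne_zero {x : R} (hx : x ≠ 0) : sgn x ^ 2 = 1 := by
  rw [← map_pow, sgn_of_pos (sq_pos_of_ne_zero hx)]

theorem one_sub_sgn_sq (x : R) [Decidable (x = 0)] :
    1 - sgn x ^ 2 = if x = 0 then 1 else 0 := by
  split_ifs with hx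
  · simp [hx]
  · simp [sgn_sq_of_ne_zero hx]

/-! ### Jumps -/

/-- The sign of `p` immediately to the right of `a`. -/
def rightSign (p : R[X]) (a : R) : ℚ :=
  sgn ((p /ₘ (X - C a) ^ p.rootMultiplicity a).eval a)

theorem rightSign_pow_mul {u : R[X]} {a : R} (hu : u.eval a ≠ 0) (m : ℕ) :
    rightSign ((X - C a) ^ m * u) a = sgn (u.eval a) := by
  rw [rightSign, rootMultiplicity_pow_mul hu,
    mul_divByMonic_cancel_left u ((monic_X_sub_C a).pow m)]

/-- Half the increment of the sign of `p` at `a`; it vanishes unless the sign changes there. -/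
def crossing (p : R[X]) (a : R) : ℚ :=
  (1 - (-1) ^ p.rootMultiplicity a) / 2 * rightSign p a

theorem crossing_pow_mul {u : R[X]} {a : R} (hu : u.eval a ≠ 0) (m : ℕ) :
    crossing ((X - C a) ^ m * u) a = (1 - (-1) ^ m) / 2 * sgn (u.eval a) := by
  rw [crossing, rootMultiplicity_pow_mul hu, rightSign_pow_mul hu]

theorem crossing_of_not_isRoot {p : R[X]} {a : R} (h : ¬ p.IsRoot a) : crossing p a = 0 := by
  simp [crossing, rootMultiplicity_eq_zero h]

theorem crossing_X_sub_C_mul_self {p : R[X]} (hp : p ≠ 0) (a : R) :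
    crossing ((X - C a) * p) a = rightSign p a - crossing p a := by
  obtain ⟨m, u, hu, rfl⟩ := exists_eq_pow_mul hp a
  rw [← mul_assoc, ← pow_succ', crossing_pow_mul hu, crossing_pow_mul hu, rightSign_pow_mul hu]
  ring

theorem crossing_X_sub_C_mul_of_lt {p : R[X]} (hp : p ≠ 0) {a x : R} (hx : x < a) :
    crossing ((X - C a) * p) x = -crossing p x := by
  obtain ⟨m, u, hu, rfl⟩ := exists_eq_pow_mul hp x
  have hxa : (X - C a).eval x < 0 := by simpa using hx
  have hau : ((X - C a) * u).eval x ≠ 0 := by simpa using ⟨sub_ne_zero.2 hx.ne, hu⟩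
  rw [mul_left_comm, crossing_pow_mul hau, crossing_pow_mul hu, eval_mul, map_mul, sgn_of_neg hxa]
  ring

/-- The jump at `a` of the rational function `q / p`: `1` if it goes from `-∞` to `+∞`, `-1` if it
goes from `+∞` to `-∞`, and `0` otherwise. -/
def jump (q p : R[X]) (a : R) : ℚ :=
  if q.rootMultiplicity a < p.rootMultiplicity a then crossing (p * q) a else 0

theorem jump_of_not_isRoot {q p : R[X]} {a : R} (h : ¬ p.IsRoot a) : jump q p a = 0 := by
  simp [jump, rootMultiplicity_eq_zero h]

theorem jump_pow_mul {u v : R[X]} {a : R} (hu : u.eval a ≠ 0) (hv : v.eval a ≠ 0) (m n : ℕ) :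
    jump ((X - C a) ^ n * v) ((X - C a) ^ m * u) a =
      if n < m then (1 - (-1) ^ (m + n)) / 2 * (sgn (u.eval a) * sgn (v.eval a)) else 0 := by
  have huv : (u * v).eval a ≠ 0 := by simp [hu, hv]
  rw [jump, rootMultiplicity_pow_mul hu, rootMultiplicity_pow_mul hv, mul_mul_mul_comm, ← pow_add,
    crossing_pow_mul huv, eval_mul, map_mul]

theorem jump_eq_zero_of_pow_dvd {q p : R[X]} {a : R}
    (h : (X - C a) ^ p.rootMultiplicity a ∣ q) : jump q p a = 0 := by
  rcases eq_or_ne q 0 with rfl | hq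
  · simp [jump, crossing]
  · exact if_neg (not_lt.2 ((le_rootMultiplicity_iff hq).2 h))

theorem jump_add_jump {p q : R[X]} (hp : p ≠ 0) (hq : q ≠ 0) (a : R) :
    jump q p a + jump p q a = crossing (p * q) a := by
  unfold jump
  rcases lt_trichotomy (q.rootMultiplicity a) (p.rootMultiplicity a) with h | h | h
  · rw [if_pos h, if_neg h.not_gt, add_zero]
  · rw [if_neg h.not_lt, if_neg h.not_gt, crossing, rootMultiplicity_mul (mul_ne_zero hp hq), h,
      Even.neg_one_pow ⟨_, rfl⟩]
    simp
  · rw [if_neg h.not_gt, if_pos h, zero_add, mul_comm q p]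

theorem jump_sub_mul {p q : R[X]} (hp : p ≠ 0) (hq : q ≠ 0) (d : R[X]) {c : R} (hc : 0 < c)
    (a : R) : jump (d * q - C c * p) q a = -jump p q a := by
  obtain ⟨m, u, hu, rfl⟩ := exists_eq_pow_mul hp a
  obtain ⟨n, v, hv, rfl⟩ := exists_eq_pow_mul hq a
  rcases lt_or_ge m n with hmn | hmn
  · obtain ⟨k, rfl⟩ := Nat.exists_eq_add_of_lt hmn
    have factorization : d * ((X - C a) ^ (m + k + 1) * v) - C c * ((X - C a) ^ m * u) =
        (X - C a) ^ m * (d * (X - C a) ^ (k + 1) * v - C c * u) := by ring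
    have eval_cofactor : (d * (X - C a) ^ (k + 1) * v - C c * u).eval a = -c * u.eval a := by simp
    have hw : (d * (X - C a) ^ (k + 1) * v - C c * u).eval a ≠ 0 := by
      rw [eval_cofactor]
      exact mul_ne_zero (neg_ne_zero.2 hc.ne') hu
    rw [factorization, jump_pow_mul hv hw, jump_pow_mul hv hu, if_pos hmn, if_pos hmn,
      eval_cofactor, map_mul, sgn_of_neg (neg_neg_of_pos hc)]
    ring
  · rw [jump_pow_mul hv hu, if_neg hmn.not_gt, neg_zero]
    refine jump_eq_zero_of_pow_dvd (dvd_sub ?_ ?_) <;> rw [rootMultiplicity_pow_mul hv]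
    · exact (dvd_mul_right _ _).mul_left d
    · exact ((pow_dvd_pow _ hmn).mul_right u).mul_left (C c)

theorem jump_derivative_mul {g : R[X]} (hg : g ≠ 0) (h : R[X]) {a : R} (ha : g.IsRoot a) :
    jump (derivative g * h) g a = sgn (h.eval a) := by
  obtain ⟨m | m, u, hu, rfl⟩ := exists_eq_pow_mul hg a
  · exact absurd ha (by simpa using hu)
  rw [derivative_pow_succ_mul]
  set w := C ((m : R) + 1) * u + (X - C a) * derivative u
  have eval_w : w.eval a = ((m : R) + 1) * u.eval a := by simp [w]
  have hm : (0 : R) < m + 1 := by positivity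
  by_cases hh : h.eval a = 0
  · rw [hh, map_zero]
    refine jump_eq_zero_of_pow_dvd ?_
    rw [rootMultiplicity_pow_mul hu, pow_succ]
    exact mul_dvd_mul (dvd_mul_right _ _) (dvd_iff_isRoot.2 hh)
  · have hwh : (w * h).eval a ≠ 0 := by simp [eval_w, hm.ne', hu, hh]
    rw [mul_assoc, jump_pow_mul hu hwh, if_pos m.lt_succ_self, eval_mul, eval_w, map_mul, map_mul,
      sgn_of_pos hm, Odd.neg_one_pow ⟨m, by ring⟩]
    linear_combination sgn (h.eval a) * sgn_sq_of_ne_zero hu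

end OrderedRing

/-! ### Cauchy indices -/

theorem sgn_eval_of_roots_lt {p : ℝ[X]} {x : ℝ} (h : ∀ y, p.IsRoot y → y < x) :
    sgn (p.eval x) = sgn p.leadingCoeff := by
  rcases sgn_cases p.leadingCoeff with ⟨hp, hsgn⟩ | ⟨hp, -⟩ | ⟨hp, hsgn⟩
  · rw [hsgn, sgn_of_neg (eval_lt_zero_of_roots_lt_of_leadingCoeff_nonpos h hp.le)]
  · rw [leadingCoeff_eq_zero.1 hp, eval_zero, leadingCoeff_zero]
  · rw [hsgn, sgn_of_pos (zero_lt_eval_of_roots_lt_of_leadingCoeff_nonneg h hp.le)]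

theorem sgn_eval_of_lt_roots {p : ℝ[X]} {x : ℝ} (h : ∀ y, p.IsRoot y → x < y) :
    sgn (p.eval x) = (-1) ^ p.natDegree * sgn p.leadingCoeff := by
  have roots_lt : ∀ y, (p.comp (-X)).IsRoot y → y < -x := fun y hy =>
    lt_neg_of_lt_neg (h (-y) (by simpa [IsRoot, eval_comp] using hy))
  simpa [eval_comp, comp_neg_X_leadingCoeff_eq, sgn_neg_one] using sgn_eval_of_roots_lt roots_lt

theorem rightSign_eq_sgn_leadingCoeff {p : ℝ[X]} (hp : p ≠ 0) {a : ℝ}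
    (h : ∀ y, p.IsRoot y → y ≤ a) : rightSign p a = sgn p.leadingCoeff := by
  obtain ⟨m, u, hu, rfl⟩ := exists_eq_pow_mul hp a
  rw [rightSign_pow_mul hu, leadingCoeff_mul, ((monic_X_sub_C a).pow m).leadingCoeff, one_mul]
  refine sgn_eval_of_roots_lt fun y hy => (h y (root_mul_left_of_isRoot _ hy)).lt_of_ne ?_
  rintro rfl
  exact hu hy

theorem exists_isRoot_forall_isRoot_le {p : ℝ[X]} (hp : p ≠ 0) (hroot : ∃ x, p.IsRoot x) :
    ∃ a, p.IsRoot a ∧ ∀ y, p.IsRoot y → y ≤ a := by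
  obtain ⟨a, ha, hmax⟩ :=
    Set.exists_max_image {x | p.IsRoot x} id (finite_setOfPred_isRoot hp) hroot
  exact ⟨a, ha, hmax⟩

theorem sum_crossing {p : ℝ[X]} (hp : p ≠ 0) {A : Finset ℝ} (hA : ∀ x, p.IsRoot x → x ∈ A) :
    ∑ x ∈ A, crossing p x =
      (sgn p.leadingCoeff - (-1) ^ p.natDegree * sgn p.leadingCoeff) / 2 := by
  induction hn : p.natDegree generalizing p with
  | zero =>
    rw [eq_C_of_natDegree_eq_zero hn]
    simp [crossing]
  | succ n ih =>
    by_cases hroot : ∃ x, p.IsRoot x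
    · obtain ⟨a, ha, hmax⟩ := exists_isRoot_forall_isRoot_le hp hroot
      obtain ⟨r, rfl⟩ := dvd_iff_isRoot.2 ha
      have hr : r ≠ 0 := right_ne_zero_of_mul hp
      have root_r : ∀ y, r.IsRoot y → ((X - C a) * r).IsRoot y := fun _ =>
        root_mul_left_of_isRoot _
      have natDegree_r : r.natDegree = n := by
        rw [natDegree_mul (X_sub_C_ne_zero a) hr, natDegree_X_sub_C] at hn
        lia
      have crossing_eq : ∀ x ∈ A, crossing ((X - C a) * r) x =
          (if x = a then sgn r.leadingCoeff else 0) - crossing r x := by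
        intro x _
        split_ifs with hxa
        · rw [hxa, crossing_X_sub_C_mul_self hr,
            rightSign_eq_sgn_leadingCoeff hr fun y hy => hmax y (root_r y hy)]
        · rw [zero_sub]
          by_cases hx : ((X - C a) * r).IsRoot x
          · exact crossing_X_sub_C_mul_of_lt hr ((hmax x hx).lt_of_ne hxa)
          · rw [crossing_of_not_isRoot hx, crossing_of_not_isRoot (mt (root_r x) hx), neg_zero]
      rw [Finset.sum_congr rfl crossing_eq, Finset.sum_sub_distrib, Finset.sum_ite_eq' A a,
        if_pos (hA a ha), ih hr (fun x hx => hA x (root_r x hx)) natDegree_r, leadingCoeff_mul,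
        leadingCoeff_X_sub_C, one_mul]
      ring
    · push Not at hroot
      have sgn_at_top : sgn (p.eval 0) = _ := sgn_eval_of_roots_lt fun y hy => absurd hy (hroot y)
      have sgn_at_bot : sgn (p.eval 0) = _ := sgn_eval_of_lt_roots fun y hy => absurd hy (hroot y)
      rw [Finset.sum_eq_zero fun x _ => crossing_of_not_isRoot (hroot x), ← hn, ← sgn_at_bot,
        sgn_at_top, sub_self, zero_div]

/-- The Cauchy index of the rational function `q / p` over the real line. -/
def cauchyIndex (q p : ℝ[X]) : ℚ := ∑ x ∈ p.roots.toFinset, jump q p x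

theorem cauchyIndex_zero_left (p : ℝ[X]) : cauchyIndex 0 p = 0 :=
  Finset.sum_eq_zero fun _ _ => jump_eq_zero_of_pow_dvd (dvd_zero _)

theorem cauchyIndex_eq_sum {q p : ℝ[X]} {A : Finset ℝ} (hp : p ≠ 0)
    (hA : ∀ x, p.IsRoot x → x ∈ A) : cauchyIndex q p = ∑ x ∈ A, jump q p x := by
  refine Finset.sum_subset (fun x hx => hA x ?_) fun x _ hx => jump_of_not_isRoot ?_
  · simpa [hp] using hx
  · simpa [hp] using hx

/-- The last summand is the number of sign changes of `p, q` at `-∞` minus that at `+∞`. -/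
theorem cauchyIndex_step {p q : ℝ[X]} (hp : p ≠ 0) (hq : q ≠ 0) (d : ℝ[X]) {c : ℝ} (hc : 0 < c) :
    cauchyIndex q p = cauchyIndex (d * q - C c * p) q +
      (sgn p.leadingCoeff * sgn q.leadingCoeff -
        (-1) ^ p.natDegree * sgn p.leadingCoeff * ((-1) ^ q.natDegree * sgn q.leadingCoeff)) /
          2 := by
  have hpq := mul_ne_zero hp hq
  have root_mem : ∀ x, (p * q).IsRoot x → x ∈ (p * q).roots.toFinset := by simp [hpq]
  have index_add : cauchyIndex q p + cauchyIndex p q =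
      ∑ x ∈ (p * q).roots.toFinset, crossing (p * q) x := by
    rw [cauchyIndex_eq_sum hp fun x hx => root_mem x (root_mul_right_of_isRoot q hx),
      cauchyIndex_eq_sum hq fun x hx => root_mem x (root_mul_left_of_isRoot p hx),
      ← Finset.sum_add_distrib]
    exact Finset.sum_congr rfl fun x _ => jump_add_jump hp hq x
  have index_remainder : cauchyIndex (d * q - C c * p) q = -cauchyIndex p q := by
    rw [cauchyIndex, cauchyIndex, ← Finset.sum_neg_distrib]
    exact Finset.sum_congr rfl fun x _ => jump_sub_mul hp hq d hc x
  rw [sum_crossing hpq root_mem, natDegree_mul hp hq, leadingCoeff_mul, map_mul] at index_add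
  rw [index_remainder]
  linear_combination index_add

/-- The Sturm–Tarski theorem. -/
theorem cauchyIndex_derivative_mul {g : ℝ[X]} (hg : g ≠ 0) (h : ℝ[X]) :
    cauchyIndex (derivative g * h) g = ∑ x ∈ g.roots.toFinset, sgn (h.eval x) :=
  Finset.sum_congr rfl fun x hx => jump_derivative_mul hg h (by simpa [hg] using hx)

/-! ### Branching on sign assumptions -/

/-- Evaluation of the coefficients at a valuation, as a ring homomorphism. -/
def evalHom (ν : List ℝ) : RealMPoly →+* ℝ := MvPolynomial.eval fun i => ν.getD i 0

/-- Specialization of a univariate polynomial: its coefficients are evaluated at a valuation. -/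
def specialize (ν : List ℝ) : RMPoly →+* ℝ[X] := mapRingHom (evalHom ν)

/-- The sign assumptions `a` hold at the valuation `ν`. -/
def Consistent (ν : List ℝ) (a : Assumps) : Prop := ∀ b ∈ a, b.2 = sgn (evalHom ν b.1)

/-- All assumed signs are among `-1, 0, 1`; other rational numbers are never the sign of anything,
although `assumpToAtom` accepts them. -/
def ProperSigns (a : Assumps) : Prop := ∀ b ∈ a, b.2 = 0 ∨ b.2 = 1 ∨ b.2 = -1

/-- The leading coefficient of `p` is assumed to be nonzero, so that specialization at a valuation
consistent with `a` preserves the degree of `p`. -/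
def LeadAssumedNonzero (a : Assumps) (p : RMPoly) : Prop := ∃ s ≠ 0, (p.leadingCoeff, s) ∈ a

theorem Consistent.mono {ν : List ℝ} {a b : Assumps} (h : Consistent ν b) (hab : a ⊆ b) :
    Consistent ν a := fun x hx => h x (hab hx)

theorem ProperSigns.mono {a b : Assumps} (h : ProperSigns b) (hab : a ⊆ b) : ProperSigns a :=
  fun x hx => h x (hab hx)

theorem LeadAssumedNonzero.mono {a b : Assumps} {p : RMPoly} (h : LeadAssumedNonzero a p)
    (hab : a ⊆ b) : LeadAssumedNonzero b p :=
  let ⟨s, hs, hmem⟩ := h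
  ⟨s, hs, hab hmem⟩

theorem consistent_cons {ν : List ℝ} {b : RealMPoly × ℚ} {a : Assumps} :
    Consistent ν (b :: a) ↔ b.2 = sgn (evalHom ν b.1) ∧ Consistent ν a :=
  List.forall_mem_cons

theorem properSigns_cons {b : RealMPoly × ℚ} {a : Assumps} :
    ProperSigns (b :: a) ↔ (b.2 = 0 ∨ b.2 = 1 ∨ b.2 = -1) ∧ ProperSigns a :=
  List.forall_mem_cons

theorem mem_of_lookupSign {c : RealMPoly} {s : ℚ} {a : Assumps} (h : lookupSign c a = some s) :
    (c, s) ∈ a := by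
  induction a with
  | nil => simp [lookupSign] at h
  | cons b a ih =>
    rw [lookupSign] at h
    split_ifs at h with hc
    · obtain rfl := Option.some_inj.1 h
      exact hc ▸ List.mem_cons_self
    · exact List.mem_cons_of_mem _ (ih h)

theorem exists_lookupSign_of_mem {c : RealMPoly} {s : ℚ} {a : Assumps} (h : (c, s) ∈ a) :
    ∃ t, lookupSign c a = some t := by
  induction a with
  | nil => simp at h
  | cons b a ih =>
    rw [lookupSign]
    split_ifs with hc
    · exact ⟨_, rfl⟩
    · exact ih ((List.mem_cons.1 h).resolve_left fun e => hc (congrArg Prod.fst e))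

section Specialization

variable {ν : List ℝ} {a : Assumps} {p : RMPoly}

theorem Consistent.lookupSign_eq (ha : Consistent ν a) {c : RealMPoly} {s : ℚ} (h : (c, s) ∈ a) :
    lookupSign c a = some (sgn (evalHom ν c)) := by
  obtain ⟨t, ht⟩ := exists_lookupSign_of_mem h
  rw [ht]
  exact congrArg some (ha _ (mem_of_lookupSign ht))

theorem LeadAssumedNonzero.lookupSign_eq (h : LeadAssumedNonzero a p) (ha : Consistent ν a) :
    lookupSign p.leadingCoeff a = some (sgn (evalHom ν p.leadingCoeff)) :=
  let ⟨_, _, hmem⟩ := h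
  ha.lookupSign_eq hmem

theorem LeadAssumedNonzero.eval_ne_zero (h : LeadAssumedNonzero a p) (ha : Consistent ν a) :
    evalHom ν p.leadingCoeff ≠ 0 := by
  obtain ⟨s, hs, hmem⟩ := h
  exact fun h0 => hs ((ha _ hmem).trans (sgn_eq_zero_iff.2 h0))

theorem leadingCoeff_specialize (h : evalHom ν p.leadingCoeff ≠ 0) :
    (specialize ν p).leadingCoeff = evalHom ν p.leadingCoeff :=
  leadingCoeff_map_of_leadingCoeff_ne_zero _ h

theorem natDegree_specialize (h : evalHom ν p.leadingCoeff ≠ 0) :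
    (specialize ν p).natDegree = p.natDegree :=
  natDegree_map_of_leadingCoeff_ne_zero _ h

theorem specialize_ne_zero (h : evalHom ν p.leadingCoeff ≠ 0) : specialize ν p ≠ 0 := by
  rwa [← leadingCoeff_ne_zero, leadingCoeff_specialize h]

theorem specialize_C (ν : List ℝ) (c : RealMPoly) : specialize ν (C c) = C (evalHom ν c) :=
  map_C _

theorem specialize_derivative (ν : List ℝ) (p : RMPoly) :
    specialize ν (derivative p) = derivative (specialize ν p) :=
  (derivative_map p _).symm

theorem specialize_eraseLead (h : evalHom ν p.leadingCoeff = 0) :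
    specialize ν p.eraseLead = specialize ν p := by
  conv_rhs => rw [← eraseLead_add_C_mul_X_pow p]
  rw [map_add, map_mul, specialize_C, h, C_0, zero_mul, add_zero]

end Specialization

/-- `L` is a list of branches that refine the assumptions `a`, one of which is consistent with `ν`
if `a` is, and the data carried by a branch that is consistent with `ν` satisfy `Q`. -/
structure IsBranching {β : Type*} (ν : List ℝ) (a : Assumps) (L : List (Assumps × β))
    (Q : Assumps → β → Prop) : Prop where
  exists_consistent : Consistent ν a → ∃ b ∈ L, Consistent ν b.1
  subset : ∀ b ∈ L, a ⊆ b.1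
  proper : ∀ b ∈ L, ProperSigns a → ProperSigns b.1
  correct : ∀ b ∈ L, Consistent ν b.1 → Q b.1 b.2

namespace IsBranching

variable {β γ : Type*} {ν : List ℝ} {a : Assumps}

theorem pure {x : β} {Q : Assumps → β → Prop} (h : Consistent ν a → Q a x) :
    IsBranching ν a [(a, x)] Q where
  exists_consistent ha := ⟨_, List.mem_singleton_self _, ha⟩
  subset := by simp
  proper := by simp
  correct := by simpa using h

theorem map {L : List (Assumps × β)} {Q : Assumps → β → Prop} {Q' : Assumps → γ → Prop}
    (h : IsBranching ν a L Q) (f : Assumps × β → γ)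
    (hQ : ∀ a' x, a ⊆ a' → Consistent ν a' → Q a' x → Q' a' (f (a', x))) :
    IsBranching ν a (L.map fun b => (b.1, f b)) Q' where
  exists_consistent ha := by simpa using h.exists_consistent ha
  subset := List.forall_mem_map.2 h.subset
  proper := List.forall_mem_map.2 h.proper
  correct := List.forall_mem_map.2 fun b hb hcons =>
    hQ _ _ (h.subset b hb) hcons (h.correct b hb hcons)

theorem imp {L : List (Assumps × β)} {Q Q' : Assumps → β → Prop} (h : IsBranching ν a L Q)
    (hQ : ∀ a' x, a ⊆ a' → Consistent ν a' → Q a' x → Q' a' x) : IsBranching ν a L Q' := by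
  simpa using h.map Prod.snd hQ

theorem flatMap {L : List (Assumps × β)} {Q : Assumps → β → Prop} {Q' : Assumps → γ → Prop}
    {k : Assumps × β → List (Assumps × γ)} (h : IsBranching ν a L Q)
    (hk : ∀ a' x, a ⊆ a' → (Consistent ν a' → Q a' x) → IsBranching ν a' (k (a', x)) Q') :
    IsBranching ν a (L.flatMap k) Q' := by
  have branching_k : ∀ b ∈ L, IsBranching ν b.1 (k b) Q' := fun b hb =>
    hk b.1 b.2 (h.subset b hb) (h.correct b hb)
  refine ⟨fun ha => ?_, ?_, ?_, ?_⟩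
  · obtain ⟨b, hb, hcons⟩ := h.exists_consistent ha
    obtain ⟨c, hc, hcons⟩ := (branching_k b hb).exists_consistent hcons
    exact ⟨c, List.mem_flatMap_of_mem hb hc, hcons⟩
  all_goals
    intro c hc
    obtain ⟨b, hb, hc⟩ := List.mem_flatMap.1 hc
  · exact List.Subset.trans (h.subset b hb) ((branching_k b hb).subset c hc)
  · exact (branching_k b hb).proper c hc ∘ h.proper b hb
  · exact (branching_k b hb).correct c hc

theorem append {L : List (Assumps × β)} {Q : Assumps → β → Prop} (h : IsBranching ν a L Q)
    {a' : Assumps} (haa' : a ⊆ a') (hQ : ∀ b c x, b ⊆ c → Q b x → Q c x) :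
    IsBranching ν a' (L.map fun b => (a' ++ b.1, b.2)) Q where
  exists_consistent ha' := by
    obtain ⟨b, hb, hcons⟩ := h.exists_consistent (ha'.mono haa')
    exact ⟨_, List.mem_map_of_mem hb, List.forall_mem_append.2 ⟨ha', hcons⟩⟩
  subset := List.forall_mem_map.2 fun b _ => List.subset_append_left a' b.1
  proper := List.forall_mem_map.2 fun b hb ha' =>
    List.forall_mem_append.2 ⟨ha', h.proper b hb (ha'.mono haa')⟩
  correct := List.forall_mem_map.2 fun b hb hcons =>
    hQ _ _ _ (List.subset_append_right a' b.1)
      (h.correct b hb (hcons.mono (List.subset_append_right a' b.1)))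

theorem trisect {L L₀ L₁ L₂ : List (Assumps × β)} {Q : Assumps → β → Prop} (c : RealMPoly)
    (hL : ∀ b, b ∈ L ↔ b ∈ L₀ ∨ b ∈ L₁ ∨ b ∈ L₂) (h₀ : IsBranching ν ((c, 0) :: a) L₀ Q)
    (h₁ : IsBranching ν ((c, 1) :: a) L₁ Q) (h₂ : IsBranching ν ((c, -1) :: a) L₂ Q) :
    IsBranching ν a L Q := by
  refine ⟨fun ha => ?_, fun b hb => ?_, fun b hb ha => ?_, fun b hb => ?_⟩
  · simp only [hL]
    rcases sgn_cases (evalHom ν c) with ⟨-, hc⟩ | ⟨-, hc⟩ | ⟨-, hc⟩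
    · exact (h₂.exists_consistent (consistent_cons.2 ⟨hc.symm, ha⟩)).imp fun b => by tauto
    · exact (h₀.exists_consistent (consistent_cons.2 ⟨hc.symm, ha⟩)).imp fun b => by tauto
    · exact (h₁.exists_consistent (consistent_cons.2 ⟨hc.symm, ha⟩)).imp fun b => by tauto
  all_goals rcases (hL b).1 hb with hb | hb | hb
  · exact List.Subset.trans (List.subset_cons_self _ _) (h₀.subset b hb)
  · exact List.Subset.trans (List.subset_cons_self _ _) (h₁.subset b hb)
  · exact List.Subset.trans (List.subset_cons_self _ _) (h₂.subset b hb)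
  · exact h₀.proper b hb (properSigns_cons.2 ⟨.inl rfl, ha⟩)
  · exact h₁.proper b hb (properSigns_cons.2 ⟨.inr (.inl rfl), ha⟩)
  · exact h₂.proper b hb (properSigns_cons.2 ⟨.inr (.inr rfl), ha⟩)
  · exact h₀.correct b hb
  · exact h₁.correct b hb
  · exact h₂.correct b hb

/-- The recursion scheme common to `spmodsAux`, `spmods` and `lcAssumps`: `k₀` continues where the
leading coefficient of `q` is assumed to vanish, and `k₁` where it is assumed not to. -/
theorem of_leadingCoeff {q : RMPoly} {L : List (Assumps × β)} {Q : ℝ[X] → Assumps → β → Prop}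
    (k₀ k₁ : Assumps → List (Assumps × β))
    (hnone : lookupSign q.leadingCoeff a = none → ∀ b, b ∈ L ↔ b ∈ k₀ ((q.leadingCoeff, 0) :: a) ∨
      b ∈ k₁ ((q.leadingCoeff, 1) :: a) ∨ b ∈ k₁ ((q.leadingCoeff, -1) :: a))
    (hzero : lookupSign q.leadingCoeff a = some 0 → L = k₀ a)
    (hsome : ∀ s ≠ 0, lookupSign q.leadingCoeff a = some s → L = k₁ a)
    (h₀ : ∀ a', a ⊆ a' → IsBranching ν a' (k₀ a') (Q (specialize ν q.eraseLead)))
    (h₁ : ∀ a', a ⊆ a' → LeadAssumedNonzero a' q → IsBranching ν a' (k₁ a') (Q (specialize ν q))) :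
    IsBranching ν a L (Q (specialize ν q)) := by
  have erase : ∀ a', a ⊆ a' → (q.leadingCoeff, 0) ∈ a' →
      IsBranching ν a' (k₀ a') (Q (specialize ν q)) := fun a' ha' hmem =>
    (h₀ a' ha').imp fun a'' x ha'' hcons h => by
      rwa [specialize_eraseLead (sgn_eq_zero_iff.1 (hcons _ (ha'' hmem)).symm)] at h
  rcases hl : lookupSign q.leadingCoeff a with _ | s
  · exact .trisect q.leadingCoeff (hnone hl)
      (erase _ (List.subset_cons_self _ _) List.mem_cons_self)
      (h₁ _ (List.subset_cons_self _ _) ⟨1, one_ne_zero, List.mem_cons_self⟩)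
      (h₁ _ (List.subset_cons_self _ _) ⟨-1, neg_ne_zero.2 one_ne_zero, List.mem_cons_self⟩)
  · rcases eq_or_ne s 0 with rfl | hs
    · rw [hzero hl]
      exact erase a (List.Subset.refl a) (mem_of_lookupSign hl)
    · rw [hsome s hs hl]
      exact h₁ a (List.Subset.refl a) ⟨s, hs, mem_of_lookupSign hl⟩

end IsBranching

/-! ### Signed pseudo-remainder sequences -/

theorem exists_pseudoModAux_eq (q : RMPoly) (k : ℕ) (r : RMPoly) :
    ∃ d, pseudoModAux q k r = C (q.leadingCoeff ^ k) * r - d * q := by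
  induction k generalizing r with
  | zero => exact ⟨0, by simp [pseudoModAux]⟩
  | succ k ih =>
    obtain ⟨d, hd⟩ := ih (C q.leadingCoeff * r - C (r.coeff (k + q.natDegree)) * X ^ k * q)
    refine ⟨d + C (q.leadingCoeff ^ k) * (C (r.coeff (k + q.natDegree)) * X ^ k), ?_⟩
    rw [pseudoModAux, hd, pow_succ, C_mul]
    ring

theorem exists_specialize_mulPseudoMod_eq {ν : List ℝ} (p : RMPoly) {q : RMPoly}
    (hq : evalHom ν q.leadingCoeff ≠ 0) : ∃ (d : ℝ[X]) (c : ℝ), 0 < c ∧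
      specialize ν (mulPseudoMod p q) = d * specialize ν q - C c * specialize ν p := by
  obtain ⟨d, hd⟩ := exists_pseudoModAux_eq q (p.natDegree + 1 - q.natDegree) p
  rw [mulPseudoMod, pseudoMod, hd]
  split_ifs with heven
  · refine ⟨specialize ν d, _, heven.pow_pos hq, ?_⟩
    simp only [map_mul, map_sub, map_pow, map_neg, map_one, specialize_C]
    ring
  · refine ⟨C (evalHom ν q.leadingCoeff) * specialize ν d, _,
      (Nat.even_add_one.2 heven).pow_pos hq, ?_⟩
    simp only [map_mul, map_sub, map_pow, map_neg, specialize_C]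
    ring

theorem signChanges_singleton (x : ℚ) : signChanges [x] = 0 := by
  by_cases hx : x = 0 <;> simp [signChanges, adjacentChanges, hx]

theorem signChanges_cons_cons {x y : ℚ} (hx : x ^ 2 = 1) (hy : y ^ 2 = 1) (l : List ℚ) :
    (signChanges (x :: y :: l) : ℚ) = (1 - x * y) / 2 + signChanges (y :: l) := by
  have hx0 : x ≠ 0 := by rintro rfl; norm_num at hx
  have hy0 : y ≠ 0 := by rintro rfl; norm_num at hy
  have signChanges_eq : signChanges (x :: y :: l) =
      (if x * y < 0 then 1 else 0) + signChanges (y :: l) := by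
    simp [signChanges, adjacentChanges, hx0, hy0]
  rw [signChanges_eq]
  rcases sq_eq_one_iff.1 hx with rfl | rfl <;>
    rcases sq_eq_one_iff.1 hy with rfl | rfl <;> norm_num

theorem tarskiOfSeq_singleton (a : Assumps) (p : RMPoly) : tarskiOfSeq a [p] = 0 := by
  simp [tarskiOfSeq, signChanges_singleton]

theorem tarskiOfSeq_cons_cons {ν : List ℝ} {a : Assumps} (ha : Consistent ν a) {p q : RMPoly}
    (hp : LeadAssumedNonzero a p) (hq : LeadAssumedNonzero a q) (ps : List RMPoly) :
    tarskiOfSeq a (p :: q :: ps) = tarskiOfSeq a (q :: ps) +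
      (sgn (specialize ν p).leadingCoeff * sgn (specialize ν q).leadingCoeff -
        (-1) ^ (specialize ν p).natDegree * sgn (specialize ν p).leadingCoeff *
        ((-1) ^ (specialize ν q).natDegree * sgn (specialize ν q).leadingCoeff)) / 2 := by
  have hp0 := hp.eval_ne_zero ha
  have hq0 := hq.eval_ne_zero ha
  have sq_neg_one_pow_mul : ∀ (n : ℕ) (x : ℚ), x ^ 2 = 1 → ((-1) ^ n * x) ^ 2 = 1 :=
    fun n x hx => by rw [mul_pow, hx, ← pow_mul, (even_two.mul_left n).neg_one_pow, one_mul]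
  rw [leadingCoeff_specialize hp0, leadingCoeff_specialize hq0, natDegree_specialize hp0,
    natDegree_specialize hq0]
  simp only [tarskiOfSeq, List.map_cons, hp.lookupSign_eq ha, hq.lookupSign_eq ha,
    Option.getD_some]
  rw [signChanges_cons_cons (sq_neg_one_pow_mul _ _ (sgn_sq_of_ne_zero hp0))
      (sq_neg_one_pow_mul _ _ (sgn_sq_of_ne_zero hq0)),
    signChanges_cons_cons (sgn_sq_of_ne_zero hp0) (sgn_sq_of_ne_zero hq0)]
  ring

theorem tarskiOfSeq_cons_eq_cauchyIndex {ν : List ℝ} {a : Assumps} (ha : Consistent ν a)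
    {p q : RMPoly} (hp : LeadAssumedNonzero a p) (hq : LeadAssumedNonzero a q) {ps : List RMPoly}
    (hps : tarskiOfSeq a (q :: ps) =
      cauchyIndex (specialize ν (mulPseudoMod p q)) (specialize ν q)) :
    tarskiOfSeq a (p :: q :: ps) = cauchyIndex (specialize ν q) (specialize ν p) := by
  have hp0 := hp.eval_ne_zero ha
  have hq0 := hq.eval_ne_zero ha
  obtain ⟨d, c, hc, hd⟩ := exists_specialize_mulPseudoMod_eq p hq0
  rw [tarskiOfSeq_cons_cons ha hp hq, hps, hd,
    ← cauchyIndex_step (specialize_ne_zero hp0) (specialize_ne_zero hq0) d hc]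

theorem isBranching_spmodsAux (ν : List ℝ) (p q : RMPoly) (a : Assumps)
    (hp : LeadAssumedNonzero a p) : IsBranching ν a (spmodsAux p q a) fun a' ps =>
      (∃ t, ps = p :: t) ∧ tarskiOfSeq a' ps = cauchyIndex (specialize ν q) (specialize ν p) := by
  rcases eq_or_ne q 0 with rfl | hq
  · rw [spmodsAux, dif_pos rfl]
    exact .pure fun _ => ⟨⟨_, rfl⟩, by rw [tarskiOfSeq_singleton, map_zero, cauchyIndex_zero_left]⟩
  refine .of_leadingCoeff (Q := fun r a' ps => (∃ t, ps = p :: t) ∧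
      tarskiOfSeq a' ps = cauchyIndex r (specialize ν p))
    (spmodsAux p q.eraseLead)
    (fun a' => (spmodsAux q (mulPseudoMod p q) a').map fun b => (b.1, p :: b.2))
    (fun hl b => ?_) (fun hl => ?_) (fun s hs hl => ?_)
    (fun a' haa' => isBranching_spmodsAux ν p q.eraseLead a' (hp.mono haa'))
    (fun a' haa' hqa' => ?_)
  · rw [spmodsAux, dif_neg hq, hl]
    simp only [List.mem_append, or_assoc]
  · rw [spmodsAux, dif_neg hq, hl]
    exact if_pos rfl
  · rw [spmodsAux, dif_neg hq, hl]
    exact if_neg hs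
  · refine (isBranching_spmodsAux ν q (mulPseudoMod p q) a' hqa').map (fun b => p :: b.2) ?_
    rintro a'' _ haa'' hcons ⟨⟨t, rfl⟩, ht⟩
    exact ⟨⟨_, rfl⟩, tarskiOfSeq_cons_eq_cauchyIndex hcons (hp.mono (List.Subset.trans haa' haa''))
      (hqa'.mono haa'') ht⟩
termination_by q.degree
decreasing_by
  · exact degree_eraseLead_lt hq
  · exact degree_mulPseudoMod_lt p q hq

theorem isBranching_spmods (ν : List ℝ) (p q : RMPoly) (a : Assumps) :
    IsBranching ν a (spmods p q a) fun a' ps =>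
      tarskiOfSeq a' ps = cauchyIndex (specialize ν q) (specialize ν p) := by
  rcases eq_or_ne p 0 with rfl | hp
  · rw [spmods, dif_pos rfl]
    exact .pure fun _ => by simp [cauchyIndex, tarskiOfSeq, signChanges, adjacentChanges]
  refine .of_leadingCoeff (Q := fun r a' ps => tarskiOfSeq a' ps = cauchyIndex (specialize ν q) r)
    (spmods p.eraseLead q) (spmodsAux p q)
    (fun hl b => ?_) (fun hl => ?_) (fun s hs hl => ?_)
    (fun a' _ => isBranching_spmods ν p.eraseLead q a')
    (fun a' _ hpa' => (isBranching_spmodsAux ν p q a' hpa').imp fun _ _ _ _ h => h.2)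
  · rw [spmods, dif_neg hp, hl]
    simp only [List.mem_append, or_assoc]
  · rw [spmods, dif_neg hp, hl]
    exact if_pos rfl
  · rw [spmods, dif_neg hp, hl]
    exact if_neg hs
termination_by p.degree
decreasing_by exact degree_eraseLead_lt hp

/-! ### Tarski queries -/

section SumOfSquares

variable {R : Type*} [CommRing R] [LinearOrder R] [IsStrictOrderedRing R]

open scoped Classical in
theorem prod_one_sub_sgn_sq (l : List R) :
    (l.map fun y => 1 - sgn y ^ 2).prod = if ∀ y ∈ l, y = 0 then 1 else 0 := by
  induction l with
  | nil => simp
  | cons y l ih =>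
    rw [List.map_cons, List.prod_cons, ih, one_sub_sgn_sq]
    by_cases hy : y = 0 <;> simp [hy]

theorem sum_sq_eq_zero_iff (l : List R) : (l.map (· ^ 2)).sum = 0 ↔ ∀ y ∈ l, y = 0 := by
  induction l with
  | nil => simp
  | cons y l ih =>
    have sum_nonneg : 0 ≤ (l.map (· ^ 2)).sum :=
      List.sum_nonneg (List.forall_mem_map.2 fun x _ => sq_nonneg x)
    rw [List.map_cons, List.sum_cons, add_eq_zero_iff_of_nonneg (sq_nonneg y) sum_nonneg, ih,
      sq_eq_zero_iff, List.forall_mem_cons]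

theorem isRoot_sum_sq_iff (l : List R[X]) (x : R) :
    (l.map (· ^ 2)).sum.IsRoot x ↔ ∀ q ∈ l, q.IsRoot x := by
  have eval_sum : (l.map (· ^ 2)).sum.eval x = ((l.map (Polynomial.eval x)).map (· ^ 2)).sum := by
    rw [← coe_evalRingHom, map_list_sum, List.map_map, List.map_map]
    simp only [Function.comp_def, map_pow]
  rw [IsRoot, eval_sum, sum_sq_eq_zero_iff, List.forall_mem_map]
  rfl

end SumOfSquares

theorem derivative_sum_sq_eq_zero {R : Type*} [CommSemiring R] {l : List R[X]}
    (hl : ∀ q ∈ l, q.natDegree = 0) : derivative (l.map (· ^ 2)).sum = 0 := by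
  rw [map_list_sum, List.map_map]
  refine List.sum_eq_zero (List.forall_mem_map.2 fun q hq => ?_)
  simp [sq, derivative_of_natDegree_zero (hl q hq)]

theorem cauchyIndex_sum_sq_of_ne_zero {p : ℝ[X]} (hp : p ≠ 0) (I : List ℝ[X]) (h : ℝ[X]) :
    cauchyIndex (derivative ((p :: I).map (· ^ 2)).sum * h) ((p :: I).map (· ^ 2)).sum =
      ∑ x ∈ p.roots.toFinset, (I.map fun q => 1 - sgn (q.eval x) ^ 2).prod * sgn (h.eval x) := by
  classical
  set g := ((p :: I).map (· ^ 2)).sum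
  have isRoot_g : ∀ x, g.IsRoot x ↔ p.IsRoot x ∧ ∀ q ∈ I, q.eval x = 0 := fun x => by
    rw [isRoot_sum_sq_iff, List.forall_mem_cons]
    rfl
  have hg : g ≠ 0 := by
    intro hg
    exact hp (Polynomial.funext fun x => by
      rw [((isRoot_g x).1 (by rw [hg, IsRoot, eval_zero])).1.eq_zero, eval_zero])
  have roots_g : g.roots.toFinset = p.roots.toFinset.filter fun x => ∀ q ∈ I, q.eval x = 0 := by
    ext x
    simp only [Multiset.mem_toFinset, mem_roots hg, Finset.mem_filter, mem_roots hp, isRoot_g]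
  rw [cauchyIndex_derivative_mul hg, roots_g, Finset.sum_filter]
  refine Finset.sum_congr rfl fun x _ => ?_
  have indicator := prod_one_sub_sgn_sq (I.map (Polynomial.eval x))
  simp only [List.map_map, Function.comp_def, List.forall_mem_map] at indicator
  rw [indicator, ite_mul, one_mul, zero_mul]

/-- If `p = 0` then every real number is a root of `p`, but `p.roots` is empty; the query agrees
with the empty sum because it is then taken of a constant. -/
theorem cauchyIndex_sum_sq {p : ℝ[X]} {I : List ℝ[X]} (hI : p = 0 → ∀ q ∈ I, q.natDegree = 0)
    (h : ℝ[X]) :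
    cauchyIndex (derivative ((p :: I).map (· ^ 2)).sum * h) ((p :: I).map (· ^ 2)).sum =
      ∑ x ∈ p.roots.toFinset, (I.map fun q => 1 - sgn (q.eval x) ^ 2).prod * sgn (h.eval x) := by
  rcases eq_or_ne p 0 with rfl | hp
  · rw [derivative_sum_sq_eq_zero (List.forall_mem_cons.2 ⟨natDegree_zero, hI rfl⟩), zero_mul,
      cauchyIndex_zero_left, roots_zero, Multiset.toFinset_zero, Finset.sum_empty]
  · exact cauchyIndex_sum_sq_of_ne_zero hp I h

theorem isBranching_tarskiQueries (ν : List ℝ) (p : RMPoly) (a : Assumps) (I J : List RMPoly)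
    (hI : Consistent ν a → specialize ν p = 0 → ∀ q ∈ I, (specialize ν q).natDegree = 0) :
    IsBranching ν a (tarskiQueries p a I J) fun _ N => N =
      ∑ x ∈ (specialize ν p).roots.toFinset,
        (I.map fun q => 1 - sgn ((specialize ν q).eval x) ^ 2).prod *
        (J.map fun q => sgn ((specialize ν q).eval x)).prod := by
  refine (isBranching_spmods ν _ _ a).map (fun b => tarskiOfSeq b.1 b.2) ?_
  intro a' ps haa' hcons htarski
  have specialize_sum_sq : specialize ν (p ^ 2 + (I.map fun q => q ^ 2).sum) =
      ((specialize ν p :: I.map (specialize ν)).map (· ^ 2)).sum := by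
    simp only [map_add, map_pow, map_list_sum, List.map_cons, List.sum_cons, List.map_map,
      Function.comp_def]
  have query := cauchyIndex_sum_sq (I := I.map (specialize ν))
    (by simpa using hI (hcons.mono haa')) (J.map (specialize ν)).prod
  rw [htarski, map_mul, specialize_derivative, specialize_sum_sq, map_list_prod, query]
  simp only [← coe_evalRingHom, map_list_prod, List.map_map, Function.comp_def]

/-! ### Vectors that are independent of the earlier ones -/

section GreedyBasis

variable {ι K V : Type*} [DivisionRing K] [AddCommGroup V] [Module K V]

variable (K) in
/-- The indices of the vectors that are not linear combinations of earlier ones, which are the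
pivot positions of row reduction. -/
def greedyBasis [Preorder ι] (v : ι → V) : Set ι :=
  {i | v i ∉ Submodule.span K (v '' {k | k < i})}

theorem mem_span_greedyBasis [Preorder ι] [WellFoundedLT ι] (v : ι → V) (i : ι) :
    v i ∈ Submodule.span K (v '' greedyBasis K v) := by
  induction i using WellFoundedLT.induction with
  | ind i ih =>
    by_cases hi : i ∈ greedyBasis K v
    · exact Submodule.subset_span ⟨i, hi, rfl⟩
    · exact Submodule.span_le.2 (Set.forall_mem_image.2 ih) (not_not.1 hi)

theorem linearIndepOn_greedyBasis [LinearOrder ι] (v : ι → V) :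
    LinearIndepOn K v (greedyBasis K v) := by
  refine linearIndepOn_of_finite _ fun t ht hfin => ?_
  lift t to Finset ι using hfin
  induction t using Finset.induction_on_max with
  | empty => simp
  | insert i t hlt ih =>
    rw [Finset.coe_insert, Set.insert_subset_iff] at ht
    rw [Finset.coe_insert]
    exact (ih ht.2).insert fun hmem => ht.1 (Submodule.span_mono (Set.image_mono hlt) hmem)

theorem card_greedyBasis [LinearOrder ι] [WellFoundedLT ι] (v : ι → V)
    [Fintype (greedyBasis K v)] :
    Fintype.card (greedyBasis K v) = Module.finrank K (Submodule.span K (Set.range v)) := by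
  have span_eq : Submodule.span K (Set.range v) =
      Submodule.span K (Set.range fun k : greedyBasis K v => v k) := by
    rw [← Set.image_eq_range]
    exact le_antisymm (Submodule.span_le.2 (Set.forall_mem_range.2 (mem_span_greedyBasis v)))
      (Submodule.span_mono (Set.image_subset_range _ _))
  rw [span_eq, finrank_span_eq_card (linearIndepOn_greedyBasis v)]

end GreedyBasis

theorem mulVec_eq_zero_of_greedyBasis {m n K : Type*} [Field K] [Preorder m] [WellFoundedLT m]
    [Fintype n] {M : Matrix m n K} {w : n → K}
    (h : ∀ i ∈ greedyBasis K M.row, M.mulVec w i = 0) : M.mulVec w = 0 := by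
  have span_le_ker : Submodule.span K (M.row '' greedyBasis K M.row) ≤
      LinearMap.ker ((dotProductBilin K K).flip w) :=
    Submodule.span_le.2 (Set.forall_mem_image.2 h)
  exact funext fun i => span_le_ker (mem_span_greedyBasis M.row i)

theorem card_greedyBasis_row {m n K : Type*} [Field K] [LinearOrder m] [Finite m]
    [Fintype n] {M : Matrix m n K} [Fintype (greedyBasis K M.row)]
    (hM : Function.Injective M.mulVec) :
    Fintype.card (greedyBasis K M.row) = Fintype.card n := by
  rw [card_greedyBasis, ← Matrix.rank_eq_finrank_span_row, Matrix.rank,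
    LinearMap.finrank_range_of_inj hM, Module.finrank_fintype_fun_eq_card]

/-! ### Reduction of matrix equations -/

theorem filter_finRange_map_get {ι : Type*} (l : List ι) (P : ι → Prop) [DecidablePred P] :
    ((List.finRange l.length).filter fun j => P (l.get j)).map l.get = l.filter P := by
  conv_rhs => rw [← List.map_get_finRange l, List.filter_map]
  rfl

theorem sum_map_filter {ι M : Type*} [AddCommMonoid M] (P : ι → Prop) [DecidablePred P]
    (f : ι → M) (l : List ι) :
    ((l.filter P).map f).sum = (l.map fun x => if P x then f x else 0).sum := by
  induction l with
  | nil => rfl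
  | cons x l ih => by_cases hx : P x <;> simp [hx, ih]

theorem sum_comp_eq_sum_map_card {ι κ R : Type*} [DecidableEq κ] [Semiring R] {T : List κ}
    (hT : T.Nodup) {Z : Finset ι} {f : ι → κ} (hf : ∀ x ∈ Z, f x ∈ T) (g : κ → R) :
    ∑ x ∈ Z, g (f x) = (T.map fun t => g t * (Z.filter fun x => f x = t).card).sum := by
  rw [← List.sum_toFinset _ hT,
    ← Finset.sum_fiberwise_of_maps_to fun x hx => List.mem_toFinset.2 (hf x hx)]
  refine Finset.sum_congr rfl fun t _ => ?_
  rw [Finset.sum_congr rfl fun x hx => by rw [(Finset.mem_filter.1 hx).2], Finset.sum_const,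
    nsmul_eq_mul']

/-- The entry of the sign matrix in the row `s` and the column `t`. -/
def rowValue (s : List ℕ × List ℕ) (t : List ℚ) : ℚ :=
  (s.1.map fun l => 1 - t.getD l 0 ^ 2).prod * (s.2.map fun l => t.getD l 0).prod

/-- The columns of the sign matrix are linearly independent. The coefficients of a linear
combination are indexed by sign assignments instead of positions. -/
def ColumnsIndependent (S : List (List ℕ × List ℕ)) (T : List (List ℚ)) : Prop :=
  ∀ w : List ℚ → ℚ, (∀ s ∈ S, (T.map fun t => rowValue s t * w t).sum = 0) → ∀ t ∈ T, w t = 0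

/-- The matrix of the equation is an invertible sign matrix for `n` polynomials. -/
structure MatrixEq.Valid (n : ℕ) (E : MatrixEq) : Prop where
  nodup : E.signs.Nodup
  length_signs : ∀ t ∈ E.signs, t.length = n
  index_lt : ∀ s ∈ E.subsets, ∀ l ∈ s.1 ++ s.2, l < n
  length_eq : E.signs.length = E.subsets.length
  independent : ColumnsIndependent E.subsets E.signs

open scoped Classical in
/-- The rows of the sign matrix that `MatrixEq.reduce` keeps. -/
def keptRows (S : List (List ℕ × List ℕ)) (T : List (List ℚ)) : List (List ℕ × List ℕ) :=
  ((List.finRange S.length).filter (· ∈ greedyBasis ℚ (signMatrix S T).row)).map S.get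

section SignMatrix

variable {S : List (List ℕ × List ℕ)} {T : List (List ℚ)}

theorem signMatrix_mulVec (S : List (List ℕ × List ℕ)) (T : List (List ℚ)) (w : List ℚ → ℚ)
    (i : Fin S.length) : (signMatrix S T).mulVec (w ∘ T.get) i =
      (T.map fun t => rowValue (S.get i) t * w t).sum :=
  Fin.sum_univ_fun_getElem T fun t => rowValue (S.get i) t * w t

theorem signMatrix_mulVec_injective (hT : T.Nodup) (h : ColumnsIndependent S T) :
    Function.Injective (signMatrix S T).mulVec := by
  refine (injective_iff_map_eq_zero (signMatrix S T).mulVecLin).2 fun u hu => ?_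
  obtain ⟨w, rfl⟩ := (List.nodup_iff_injective_get.1 hT).surjective_comp_right u
  refine funext fun j => h w (fun s hs => ?_) _ (T.get_mem j)
  obtain ⟨i, rfl⟩ := List.get_of_mem hs
  rw [← signMatrix_mulVec]
  exact congrFun hu i

theorem keptRows_subset (S : List (List ℕ × List ℕ)) (T : List (List ℚ)) : keptRows S T ⊆ S :=
  fun _ hs =>
    let ⟨i, _, hi⟩ := List.mem_map.1 hs
    hi ▸ S.get_mem i

theorem length_keptRows (hT : T.Nodup) (h : ColumnsIndependent S T) :
    (keptRows S T).length = T.length := by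
  classical
  have nodup_indices := (List.nodup_finRange S.length).filter
    fun i => decide (i ∈ greedyBasis ℚ (signMatrix S T).row)
  rw [keptRows, List.length_map, ← List.toFinset_card_of_nodup nodup_indices,
    List.toFinset_filter, List.toFinset_finRange]
  simpa only [decide_eq_true_eq, Fintype.card_subtype, Fintype.card_fin] using
    card_greedyBasis_row (signMatrix_mulVec_injective hT h)

theorem columnsIndependent_keptRows (h : ColumnsIndependent S T) :
    ColumnsIndependent (keptRows S T) T := by
  intro w hw
  refine h w fun s hs => ?_
  obtain ⟨i, rfl⟩ := List.get_of_mem hs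
  rw [← signMatrix_mulVec, mulVec_eq_zero_of_greedyBasis fun k hk => ?_, Pi.zero_apply]
  rw [signMatrix_mulVec]
  exact hw _ (List.mem_map.2 ⟨k, by simpa using hk, rfl⟩)

theorem columnsIndependent_filter (h : ColumnsIndependent S T) (P : List ℚ → Prop)
    [DecidablePred P] : ColumnsIndependent S (T.filter P) := by
  intro w hw t ht
  obtain ⟨htT, htP⟩ := List.mem_filter.1 ht
  have extended := h (fun t => if P t then w t else 0) (fun s hs => by
    simpa only [mul_ite, mul_zero, ← sum_map_filter] using hw s hs) t htT
  rwa [if_pos (of_decide_eq_true htP)] at extended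

end SignMatrix

namespace MatrixEq

variable {n : ℕ} {E : MatrixEq}

theorem signs_reduce (E : MatrixEq) (w : List ℚ → ℚ) [DecidablePred fun t => w t ≠ 0] :
    (E.reduce (w ∘ E.signs.get)).signs = E.signs.filter fun t => w t ≠ 0 := by
  rw [← filter_finRange_map_get, reduce]
  congr!

theorem subsets_reduce (E : MatrixEq) (w : Fin E.signs.length → ℚ) :
    (E.reduce w).subsets = keptRows E.subsets (E.reduce w).signs := by
  rw [keptRows, reduce]
  congr!

theorem Valid.reduce (hE : E.Valid n) (w : List ℚ → ℚ) :
    (E.reduce (w ∘ E.signs.get)).Valid n := by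
  classical
  have independent := columnsIndependent_filter hE.independent (w · ≠ 0)
  have nodup := hE.nodup.filter (w · ≠ 0)
  rw [← signs_reduce] at independent nodup
  refine ⟨nodup, fun t ht => ?_, fun s hs => ?_, ?_, ?_⟩
  · rw [signs_reduce] at ht
    exact hE.length_signs t (List.mem_of_mem_filter ht)
  · rw [subsets_reduce] at hs
    exact hE.index_lt s (keptRows_subset _ _ hs)
  · rw [subsets_reduce, length_keptRows nodup independent]
  · rw [subsets_reduce]
    exact columnsIndependent_keptRows independent

theorem Valid.solve_eq (hE : E.Valid n) (w : List ℚ → ℚ) :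
    E.solve (E.subsets.map fun s => (E.signs.map fun t => rowValue s t * w t).sum) =
      w ∘ E.signs.get := by
  set M := (signMatrix E.subsets E.signs).submatrix (Fin.cast hE.length_eq) id
  have mulVec_injective : Function.Injective M.mulVec := fun u u' h =>
    signMatrix_mulVec_injective hE.nodup hE.independent
      (funext fun i => congrFun h (Fin.cast hE.length_eq.symm i))
  have isUnit_det : IsUnit M.det :=
    (Matrix.isUnit_iff_isUnit_det M).1 (Matrix.mulVec_injective_iff_isUnit.1 mulVec_injective)
  have rhs_eq : (fun i : Fin E.signs.length => (E.subsets.map fun s =>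
      (E.signs.map fun t => rowValue s t * w t).sum).getD i 0) = M.mulVec (w ∘ E.signs.get) := by
    funext i
    have hi : (i : ℕ) < E.subsets.length := hE.length_eq ▸ i.isLt
    rw [List.getD_eq_getElem _ _ (by rwa [List.length_map]), List.getElem_map]
    exact (signMatrix_mulVec _ _ w (Fin.cast hE.length_eq i)).symm
  rw [MatrixEq.solve, dif_pos hE.length_eq, rhs_eq, Matrix.mulVec_mulVec,
    Matrix.nonsing_inv_mul M isUnit_det, Matrix.one_mulVec]

end MatrixEq

/-! ### Base cases and combination of matrix equations -/

theorem emptyCase_valid : emptyCase.Valid 0 where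
  nodup := by simp [emptyCase]
  length_signs := by simp [emptyCase]
  index_lt := by simp [emptyCase]
  length_eq := rfl
  independent w hw := by simpa [emptyCase, rowValue] using hw

theorem baseCase_valid : baseCase.Valid 1 where
  nodup := by simp [baseCase]; norm_num
  length_signs := by simp [baseCase]
  index_lt := by simp [baseCase]
  length_eq := rfl
  independent w hw := by
    obtain ⟨total, zeros, signed⟩ : w [1] + (w [0] + w [-1]) = 0 ∧ w [0] = 0 ∧
        w [1] + -w [-1] = 0 := by simpa [baseCase, rowValue] using hw
    simp only [baseCase, List.forall_mem_cons, List.not_mem_nil, false_imp_iff, implies_true,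
      and_true]
    exact ⟨by linarith, zeros, by linarith⟩

theorem rowValue_append {n : ℕ} {s : List ℕ × List ℕ} {σ : List ℚ} (hσ : σ.length = n)
    (hs : ∀ l ∈ s.1 ++ s.2, l < n) (t : List ℕ × List ℕ) (τ : List ℚ) :
    rowValue (s.1 ++ t.1.map (fun l => l + n), s.2 ++ t.2.map (fun l => l + n)) (σ ++ τ) =
      rowValue s σ * rowValue t τ := by
  subst hσ
  have getD_left : ∀ l ∈ s.1 ++ s.2, (σ ++ τ).getD l 0 = σ.getD l 0 := fun l hl =>
    List.getD_append _ _ _ _ (hs l hl)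
  have getD_right : ∀ l, (σ ++ τ).getD (l + σ.length) 0 = τ.getD l 0 := fun l => by
    rw [List.getD_append_right _ _ _ _ (Nat.le_add_left _ _), Nat.add_sub_cancel]
  have left₁ : s.1.map (fun l => 1 - (σ ++ τ).getD l 0 ^ 2) = s.1.map fun l => 1 - σ.getD l 0 ^ 2 :=
    List.map_congr_left fun l hl => by rw [getD_left l (List.mem_append_left _ hl)]
  have left₂ : s.2.map (fun l => (σ ++ τ).getD l 0) = s.2.map fun l => σ.getD l 0 :=
    List.map_congr_left fun l hl => getD_left l (List.mem_append_right _ hl)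
  simp only [rowValue, List.map_append, List.prod_append, List.map_map, Function.comp_def,
    getD_right, left₁, left₂]
  ring

theorem nodup_flatMap_append {α : Type*} {n : ℕ} {L L' : List (List α)} (hL : L.Nodup)
    (hlen : ∀ s ∈ L, s.length = n) (hL' : L'.Nodup) :
    (L.flatMap fun s => L'.map fun t => s ++ t).Nodup := by
  refine List.nodup_flatMap.2 ⟨fun s _ => hL'.map (List.append_right_injective s), ?_⟩
  refine hL.imp_of_mem fun {s s'} hs hs' hne x hx hx' => ?_
  obtain ⟨t, -, rfl⟩ := List.mem_map.1 hx
  obtain ⟨t', -, happend⟩ := List.mem_map.1 hx'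
  exact hne (List.append_inj happend ((hlen s' hs').trans (hlen s hs).symm)).1.symm

theorem ColumnsIndependent.combine {n : ℕ} {E₁ E₂ : MatrixEq}
    (hlen : ∀ σ ∈ E₁.signs, σ.length = n) (hlt : ∀ s ∈ E₁.subsets, ∀ l ∈ s.1 ++ s.2, l < n)
    (h₁ : ColumnsIndependent E₁.subsets E₁.signs) (h₂ : ColumnsIndependent E₂.subsets E₂.signs) :
    ColumnsIndependent (combine n E₁ E₂).subsets (combine n E₁ E₂).signs := by
  intro w hw
  have inner : ∀ σ ∈ E₁.signs, ∀ t ∈ E₂.subsets,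
      (E₂.signs.map fun τ => rowValue t τ * w (σ ++ τ)).sum = 0 := by
    intro σ₀ hσ₀ t ht
    refine h₁ (fun σ => (E₂.signs.map fun τ => rowValue t τ * w (σ ++ τ)).sum)
      (fun s hs => ?_) σ₀ hσ₀
    rw [← hw _ (List.mem_flatMap.2 ⟨s, hs, List.mem_map.2 ⟨t, ht, rfl⟩⟩), HybridQE.combine,
      List.map_flatMap, List.flatMap_def, List.sum_flatten, List.map_map]
    refine congrArg List.sum (List.map_congr_left fun σ hσ => ?_)
    simp only [Function.comp_apply, List.map_map, Function.comp_def, ← List.sum_map_mul_left,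
      rowValue_append (hlen σ hσ) (hlt s hs), mul_assoc]
  refine List.forall_mem_flatMap.2 fun σ hσ => List.forall_mem_map.2 fun τ hτ => ?_
  exact h₂ (fun τ => w (σ ++ τ)) (inner σ hσ) τ hτ

theorem MatrixEq.Valid.combine {n k : ℕ} {E₁ E₂ : MatrixEq} (h₁ : E₁.Valid n) (h₂ : E₂.Valid k) :
    (combine n E₁ E₂).Valid (n + k) where
  nodup := nodup_flatMap_append h₁.nodup h₁.length_signs h₂.nodup
  length_signs := List.forall_mem_flatMap.2 fun s hs => List.forall_mem_map.2 fun t ht => by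
    rw [List.length_append, h₁.length_signs s hs, h₂.length_signs t ht]
  index_lt := List.forall_mem_flatMap.2 fun s hs => List.forall_mem_map.2 fun t ht => by
    have left_lt := h₁.index_lt s hs
    have right_lt := h₂.index_lt t ht
    simp only [List.forall_mem_append, List.forall_mem_map] at left_lt right_lt ⊢
    grind
  length_eq := by
    simp [HybridQE.combine, List.length_flatMap, h₁.length_eq, h₂.length_eq]
  independent := h₁.independent.combine h₁.length_signs h₁.index_lt h₂.independent

/-! ### Sample points for sign conditions -/

theorem sgn_eval_eq_of_no_root {q : ℝ[X]} {x y : ℝ} (h : ∀ z ∈ Set.uIcc x y, ¬ q.IsRoot z) :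
    sgn (q.eval x) = sgn (q.eval y) := by
  have zero_notMem : (0 : ℝ) ∉ Set.uIcc (q.eval x) (q.eval y) := fun h0 =>
    let ⟨z, hz, hz0⟩ := intermediate_value_uIcc q.continuous.continuousOn h0
    h z hz hz0
  have hx : q.eval x ≠ 0 := h x Set.left_mem_uIcc
  have hy : q.eval y ≠ 0 := h y Set.right_mem_uIcc
  rcases hx.lt_or_gt with hx | hx <;> rcases hy.lt_or_gt with hy | hy
  · rw [sgn_of_neg hx, sgn_of_neg hy]
  · exact absurd (Set.mem_uIcc.2 (.inl ⟨hx.le, hy.le⟩)) zero_notMem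
  · exact absurd (Set.mem_uIcc.2 (.inr ⟨hy.le, hx.le⟩)) zero_notMem
  · rw [sgn_of_pos hx, sgn_of_pos hy]

theorem exists_adjacent_roots {f : ℝ[X]} (hf : f ≠ 0) {x a b : ℝ} (hx : ¬ f.IsRoot x)
    (ha : f.IsRoot a) (hax : a ≤ x) (hb : f.IsRoot b) (hxb : x ≤ b) :
    ∃ a' b', f.IsRoot a' ∧ f.IsRoot b' ∧ a' < x ∧ x < b' ∧ ∀ z ∈ Set.Ioo a' b', ¬ f.IsRoot z := by
  have finite_roots : {z | f.IsRoot z}.Finite := finite_setOfPred_isRoot hf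
  obtain ⟨a', ⟨ha', hax'⟩, ha'_max⟩ :=
    (finite_roots.inter_of_left (Set.Iic x)).exists_maximalFor id _ ⟨a, ha, hax⟩
  obtain ⟨b', ⟨hb', hxb'⟩, hb'_min⟩ :=
    (finite_roots.inter_of_left (Set.Ici x)).exists_minimalFor id _ ⟨b, hb, hxb⟩
  refine ⟨a', b', ha', hb', hax'.lt_of_ne fun h => hx (h ▸ ha'),
    lt_of_le_of_ne hxb' fun h => hx (h ▸ hb'), fun z hz hz0 => ?_⟩
  rcases le_total z x with h | h
  · exact hz.1.not_ge (ha'_max ⟨hz0, h⟩ hz.1.le)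
  · exact hz.2.not_ge (hb'_min ⟨hz0, h⟩ hz.2.le)

theorem exists_derivative_isRoot_of_between_roots {f : ℝ[X]} (hf : f ≠ 0) {x a b : ℝ}
    (hx : ¬ f.IsRoot x) (ha : f.IsRoot a) (hax : a ≤ x) (hb : f.IsRoot b) (hxb : x ≤ b) :
    ∃ c, (derivative f).IsRoot c ∧ ∀ z ∈ Set.uIcc c x, ¬ f.IsRoot z := by
  obtain ⟨a', b', ha', hb', hax', hxb', no_root⟩ := exists_adjacent_roots hf hx ha hax hb hxb
  obtain ⟨c, hc, hc0⟩ := exists_deriv_eq_zero (hax'.trans hxb') f.continuous.continuousOn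
    (ha'.eq_zero.trans hb'.eq_zero.symm)
  rw [Polynomial.deriv] at hc0
  exact ⟨c, hc0, fun z hz => no_root z (Set.ordConnected_Ioo.uIcc_subset hc ⟨hax', hxb'⟩ hz)⟩

section Divisors

variable {f : ℝ[X]}

theorem natDegree_eq_zero_of_mul_derivative_eq_zero (hf : f ≠ 0) (h : f * derivative f = 0)
    {q : ℝ[X]} (hq : q ∣ f) : q.natDegree = 0 := by
  have derivative_eq : derivative f = 0 := (mul_eq_zero.1 h).resolve_left hf
  exact Nat.eq_zero_of_le_zero (derivative_eq_zero.1 derivative_eq ▸ natDegree_le_of_dvd hq hf)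

theorem exists_sample_point (hf : f ≠ 0) (x : ℝ) :
    (∃ y ∈ (f * derivative f).roots.toFinset, ∀ q, q ∣ f → sgn (q.eval y) = sgn (q.eval x)) ∨
    (∀ q, q ∣ f → sgn (q.eval x) = sgn q.leadingCoeff) ∨
    (∀ q, q ∣ f → sgn (q.eval x) = (-1) ^ q.natDegree * sgn q.leadingCoeff) := by
  by_cases hlt : ∀ y, f.IsRoot y → y < x
  · exact .inr (.inl fun q hq => sgn_eval_of_roots_lt fun y hy => hlt y (hy.dvd hq))
  by_cases hgt : ∀ y, f.IsRoot y → x < y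
  · exact .inr (.inr fun q hq => sgn_eval_of_lt_roots fun y hy => hgt y (hy.dvd hq))
  push Not at hlt hgt
  obtain ⟨b, hb, hxb⟩ := hlt
  obtain ⟨a, ha, hax⟩ := hgt
  have mul_derivative_ne_zero : f * derivative f ≠ 0 := fun h => by
    have natDegree_eq := natDegree_eq_zero_of_mul_derivative_eq_zero hf h (dvd_refl f)
    rw [eq_C_of_natDegree_eq_zero natDegree_eq, IsRoot, eval_C] at ha
    rw [eq_C_of_natDegree_eq_zero natDegree_eq, ha, C_0] at hf
    exact hf rfl
  simp only [Multiset.mem_toFinset, mem_roots mul_derivative_ne_zero, root_mul]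
  by_cases hx : f.IsRoot x
  · exact .inl ⟨x, .inl hx, fun _ _ => rfl⟩
  · obtain ⟨c, hc, no_root⟩ := exists_derivative_isRoot_of_between_roots hf hx ha hax hb hxb
    exact .inl ⟨c, .inr hc, fun q hq => sgn_eval_eq_of_no_root fun z hz hz0 =>
      no_root z hz (hz0.dvd hq)⟩

theorem exists_sgn_eval_eq_sgn_leadingCoeff (hf : f ≠ 0) :
    ∃ x, ∀ q, q ∣ f → sgn (q.eval x) = sgn q.leadingCoeff := by
  obtain ⟨M, hM⟩ := (finite_setOfPred_isRoot hf).bddAbove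
  exact ⟨M + 1, fun q hq => sgn_eval_of_roots_lt fun y hy =>
    (hM (hy.dvd hq)).trans_lt (lt_add_one M)⟩

theorem exists_sgn_eval_eq_neg_one_pow_mul (hf : f ≠ 0) :
    ∃ x, ∀ q, q ∣ f → sgn (q.eval x) = (-1) ^ q.natDegree * sgn q.leadingCoeff := by
  obtain ⟨M, hM⟩ := (finite_setOfPred_isRoot hf).bddBelow
  exact ⟨M - 1, fun q hq => sgn_eval_of_lt_roots fun y hy =>
    (sub_one_lt M).trans_le (hM (hy.dvd hq))⟩

end Divisors

section ProdNonzero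

variable {M : Type*} [CommMonoidWithZero M]

open scoped Classical in
/-- The product of the nonzero members of a list, of which `polyP` is made. -/
def prodNonzero (l : List M) : M := (l.filter (· ≠ 0)).prod

theorem prodNonzero_ne_zero [NoZeroDivisors M] [Nontrivial M] (l : List M) :
    prodNonzero l ≠ 0 :=
  List.prod_ne_zero (by simp)

theorem dvd_prodNonzero {l : List M} {q : M} (hq : q ∈ l) (hq0 : q ≠ 0) : q ∣ prodNonzero l :=
  List.dvd_prod (List.mem_filter.2 ⟨hq, by simpa using hq0⟩)

theorem map_prodNonzero {N F : Type*} [CommMonoidWithZero N] [FunLike F M N]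
    [MonoidWithZeroHomClass F M N] (φ : F) {l : List M} (h : ∀ q ∈ l, φ q = 0 → q = 0) :
    φ (prodNonzero l) = prodNonzero (l.map φ) := by
  classical
  rw [prodNonzero, prodNonzero, map_list_prod, List.filter_map]
  congr 2
  refine List.filter_congr fun q hq => ?_
  have eq_zero_iff : q = 0 ↔ φ q = 0 := ⟨fun h0 => by rw [h0, map_zero], h q hq⟩
  simpa using eq_zero_iff

end ProdNonzero

/-- The signs of the polynomials `Q` at the point `x`. -/
def signsAt (Q : List ℝ[X]) (x : ℝ) : List ℚ := Q.map fun q => sgn (q.eval x)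

/-- The signs of the polynomials `Q` at `+∞`. -/
def signsAtTop (Q : List ℝ[X]) : List ℚ := Q.map fun q => sgn q.leadingCoeff

/-- The signs of the polynomials `Q` at `-∞`. -/
def signsAtBot (Q : List ℝ[X]) : List ℚ :=
  Q.map fun q => (-1) ^ q.natDegree * sgn q.leadingCoeff

theorem signsAt_append (Q₁ Q₂ : List ℝ[X]) (x : ℝ) :
    signsAt (Q₁ ++ Q₂) x = signsAt Q₁ x ++ signsAt Q₂ x :=
  List.map_append

theorem getD_signsAt (Q : List ℝ[X]) (x : ℝ) (l : ℕ) :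
    (signsAt Q x).getD l 0 = sgn ((Q.getD l 0).eval x) := by
  rw [← List.getD_map (f := fun q : ℝ[X] => sgn (q.eval x)), eval_zero, map_zero, signsAt]

theorem map_eq_map_of_dvd_prodNonzero {Q : List ℝ[X]} {g g' : ℝ[X] → ℚ} (h0 : g 0 = g' 0)
    (h : ∀ q, q ∣ prodNonzero Q → g q = g' q) : Q.map g = Q.map g' := by
  refine List.map_congr_left fun q hq => ?_
  rcases eq_or_ne q 0 with rfl | hq0
  · exact h0
  · exact h q (dvd_prodNonzero hq hq0)

theorem exists_signsAt_eq_iff (Q : List ℝ[X]) (t : List ℚ) : (∃ x, signsAt Q x = t) ↔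
    t = signsAtTop Q ∨ t = signsAtBot Q ∨
      ∃ x ∈ (prodNonzero Q * derivative (prodNonzero Q)).roots.toFinset, signsAt Q x = t := by
  have prod_ne_zero := prodNonzero_ne_zero Q
  constructor
  · rintro ⟨x, rfl⟩
    rcases exists_sample_point prod_ne_zero x with ⟨y, hy, h⟩ | h | h
    · exact .inr (.inr ⟨y, hy, map_eq_map_of_dvd_prodNonzero (by simp) h⟩)
    · exact .inl (map_eq_map_of_dvd_prodNonzero (by simp) h)
    · exact .inr (.inl (map_eq_map_of_dvd_prodNonzero (by simp) h))
  · rintro (rfl | rfl | ⟨x, -, rfl⟩)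
    · exact (exists_sgn_eval_eq_sgn_leadingCoeff prod_ne_zero).imp fun x h =>
        map_eq_map_of_dvd_prodNonzero (by simp) h
    · exact (exists_sgn_eval_eq_neg_one_pow_mul prod_ne_zero).imp fun x h =>
        map_eq_map_of_dvd_prodNonzero (by simp) h
    · exact ⟨x, rfl⟩

/-! ### Correctness of the matrix equations -/

/-- The matrix of the equation is invertible, and its columns are exactly the sign assignments to
`Q` at the roots of `p`. -/
structure MatrixEq.Determines (E : MatrixEq) (p : ℝ[X]) (Q : List ℝ[X]) : Prop
    extends E.Valid Q.length where
  mem_signs : ∀ t, t ∈ E.signs ↔ ∃ x ∈ p.roots.toFinset, signsAt Q x = t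

theorem MatrixEq.Valid.determines_reduce {E : MatrixEq} {p : ℝ[X]} {Q : List ℝ[X]}
    (hE : E.Valid Q.length) (hmem : ∀ x ∈ p.roots.toFinset, signsAt Q x ∈ E.signs) :
    (E.reduce (E.solve (E.subsets.map fun s =>
      ∑ x ∈ p.roots.toFinset, rowValue s (signsAt Q x)))).Determines p Q := by
  classical
  simp only [sum_comp_eq_sum_map_card hE.nodup hmem, hE.solve_eq fun t =>
    ((p.roots.toFinset.filter fun x => signsAt Q x = t).card : ℚ)]
  refine ⟨hE.reduce _, fun t => ?_⟩
  rw [signs_reduce]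
  simp only [List.mem_filter, decide_eq_true_eq, Nat.cast_ne_zero, Finset.card_ne_zero,
    Finset.filter_nonempty_iff, and_iff_right_iff_imp]
  rintro ⟨x, hx, rfl⟩
  exact hmem x hx

theorem isBranching_rhsVectors {ν : List ℝ} {p : RMPoly} {qs : List RMPoly}
    (S : List (List ℕ × List ℕ)) {a : Assumps}
    (hqs : Consistent ν a → specialize ν p = 0 → ∀ q ∈ qs, (specialize ν q).natDegree = 0) :
    IsBranching ν a (rhsVectors p qs S a) fun _ v => v = S.map fun s =>
      ∑ x ∈ (specialize ν p).roots.toFinset, rowValue s (signsAt (qs.map (specialize ν)) x) := by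
  induction S generalizing a with
  | nil => exact .pure fun _ => rfl
  | cons s S ih =>
    have getD_signs : ∀ x l, (signsAt (qs.map (specialize ν)) x).getD l 0 =
        sgn ((specialize ν (qs.getD l 0)).eval x) := fun x l => by
      rw [getD_signsAt, ← map_zero (specialize ν), List.getD_map]
    refine (isBranching_tarskiQueries ν p a _ _ fun ha hp => List.forall_mem_map.2 fun l _ => ?_)
      |>.flatMap fun a' N haa' hN => ?_
    · rcases lt_or_ge l qs.length with hl | hl
      · rw [List.getD_eq_getElem _ _ hl]
        exact hqs ha hp _ (List.getElem_mem hl)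
      · rw [List.getD_eq_default _ _ hl, map_zero, natDegree_zero]
    · refine (ih fun ha' => hqs (ha'.mono haa')).map (fun c => N :: c.2) ?_
      rintro a'' v ha'' hcons rfl
      rw [hN (hcons.mono ha'')]
      simp only [List.map_cons, rowValue, getD_signs, List.map_map, Function.comp_def]

theorem isBranching_reduceSystem {ν : List ℝ} {p : RMPoly} {qs : List RMPoly} {a : Assumps}
    {E : MatrixEq}
    (hqs : Consistent ν a → specialize ν p = 0 → ∀ q ∈ qs, (specialize ν q).natDegree = 0)
    (hE : Consistent ν a → E.Valid qs.length)
    (hmem : Consistent ν a → ∀ x ∈ (specialize ν p).roots.toFinset,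
      signsAt (qs.map (specialize ν)) x ∈ E.signs) :
    IsBranching ν a (reduceSystem p qs a E) fun _ E' =>
      E'.Determines (specialize ν p) (qs.map (specialize ν)) := by
  refine (isBranching_rhsVectors E.subsets hqs).map (fun b => E.reduce (E.solve b.2)) ?_
  rintro a' v haa' hcons rfl
  have ha := hcons.mono haa'
  exact MatrixEq.Valid.determines_reduce (by rw [List.length_map]; exact hE ha) (hmem ha)

theorem MatrixEq.Determines.signsAt_append_mem_combine {E₁ E₂ : MatrixEq} {p : ℝ[X]}
    {Q₁ Q₂ : List ℝ[X]} (h₁ : E₁.Determines p Q₁) (h₂ : E₂.Determines p Q₂) (n : ℕ) {x : ℝ}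
    (hx : x ∈ p.roots.toFinset) : signsAt (Q₁ ++ Q₂) x ∈ (combine n E₁ E₂).signs := by
  rw [signsAt_append]
  exact List.mem_flatMap.2 ⟨_, (h₁.mem_signs _).2 ⟨x, hx, rfl⟩,
    List.mem_map_of_mem ((h₂.mem_signs _).2 ⟨x, hx, rfl⟩)⟩

theorem isBranching_calculateData {ν : List ℝ} {p : RMPoly} {a : Assumps} {qs : List RMPoly}
    (hqs : Consistent ν a → specialize ν p = 0 → ∀ q ∈ qs, (specialize ν q).natDegree = 0) :
    IsBranching ν a (calculateData p qs a) fun _ E =>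
      E.Determines (specialize ν p) (qs.map (specialize ν)) := by
  induction qs using calculateData.induct p a with
  | case1 qs hlen =>
    rw [calculateData, dif_pos hlen]
    match qs, hlen with
    | [], _ =>
      exact isBranching_reduceSystem hqs (fun _ => emptyCase_valid) fun _ x _ => by
        simp [signsAt, emptyCase]
    | [q], _ =>
      refine isBranching_reduceSystem hqs (fun _ => baseCase_valid) fun _ x _ => ?_
      rcases sgn_cases ((specialize ν q).eval x) with ⟨-, h⟩ | ⟨-, h⟩ | ⟨-, h⟩ <;>
        simp [signsAt, baseCase, h]
  | case2 qs hlen n ih_left ih_right =>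
    have left := ih_left fun ha hp q hq => hqs ha hp q (List.mem_of_mem_take hq)
    have right := ih_right fun ha hp q hq => hqs ha hp q (List.mem_of_mem_drop hq)
    have length_take : (qs.take n).length = n := List.length_take_of_le (Nat.div_le_self _ _)
    rw [calculateData, dif_neg hlen]
    refine left.flatMap fun a₁ E₁ ha₁ hE₁ => ?_
    suffices h : IsBranching ν a₁ (((calculateData p (qs.drop n) a).map fun c =>
        (a₁ ++ c.1, c.2)).flatMap fun c => reduceSystem p qs c.1 (combine n E₁ c.2))
        fun _ E => E.Determines (specialize ν p) (qs.map (specialize ν)) by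
      rwa [List.flatMap_map] at h
    refine (right.append ha₁ fun _ _ _ _ => id).flatMap fun a₂ E₂ ha₂ hE₂ => ?_
    refine isBranching_reduceSystem
      (fun ha => hqs (ha.mono (List.Subset.trans ha₁ ha₂))) (fun ha => ?_) fun ha x hx => ?_
    · have valid := (hE₁ (ha.mono ha₂)).toValid.combine (hE₂ ha).toValid
      rwa [List.length_map, List.length_map, ← List.length_append, List.take_append_drop,
        length_take] at valid
    · have mem := (hE₁ (ha.mono ha₂)).signsAt_append_mem_combine (hE₂ ha) n hx
      rwa [← List.map_append, List.take_append_drop] at mem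

/-! ### Correctness of sign determination -/

theorem isBranching_lcAssumps (ν : List ℝ) (q : RMPoly) (a : Assumps) :
    IsBranching ν a (lcAssumps q a) fun a' q' =>
      specialize ν q' = specialize ν q ∧ (q' = 0 ∨ LeadAssumedNonzero a' q') := by
  rcases eq_or_ne q 0 with rfl | hq
  · rw [lcAssumps, dif_pos rfl]
    exact .pure fun _ => ⟨rfl, .inl rfl⟩
  refine .of_leadingCoeff
    (Q := fun r a' q' => specialize ν q' = r ∧ (q' = 0 ∨ LeadAssumedNonzero a' q'))
    (lcAssumps q.eraseLead) (fun a' => [(a', q)])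
    (fun hl b => ?_) (fun hl => ?_) (fun s hs hl => ?_)
    (fun a' _ => isBranching_lcAssumps ν q.eraseLead a')
    (fun a' _ hqa' => .pure fun _ => ⟨rfl, .inr hqa'⟩)
  · rw [lcAssumps, dif_neg hq, hl]
    simp only [List.mem_cons, List.not_mem_nil, or_false]
    tauto
  · rw [lcAssumps, dif_neg hq, hl]
    exact if_pos rfl
  · rw [lcAssumps, dif_neg hq, hl]
    exact if_neg hs
termination_by q.degree
decreasing_by exact degree_eraseLead_lt hq

theorem isBranching_lcAssumpsList (ν : List ℝ) (qs : List RMPoly) (a : Assumps) :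
    IsBranching ν a (lcAssumpsList qs a) fun a' qs' =>
      qs'.map (specialize ν) = qs.map (specialize ν) ∧
        ∀ q ∈ qs', q = 0 ∨ LeadAssumedNonzero a' q := by
  induction qs generalizing a with
  | nil => exact .pure fun _ => ⟨rfl, by simp⟩
  | cons q qs ih =>
    refine (isBranching_lcAssumps ν q a).flatMap fun a' q' _ hq' => ?_
    refine (ih a').map (fun c => q' :: c.2) ?_
    rintro a'' qs' ha'' hcons ⟨map_eq, hlead⟩
    obtain ⟨specialize_eq, hlead'⟩ := hq' (hcons.mono ha'')
    exact ⟨by rw [List.map_cons, List.map_cons, map_eq, specialize_eq],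
      List.forall_mem_cons.2 ⟨hlead'.imp_right fun h => h.mono ha'', hlead⟩⟩

theorem polyP_eq_mul_derivative (qs : List RMPoly) :
    polyP qs = prodNonzero qs * derivative (prodNonzero qs) := by
  simp only [polyP, prodNonzero]
  congr!

section Simplified

variable {ν : List ℝ} {a : Assumps} {qs : List RMPoly} (ha : Consistent ν a)
  (hqs : ∀ q ∈ qs, q = 0 ∨ LeadAssumedNonzero a q)

include ha hqs

theorem posLimit_eq_signsAtTop : posLimit a qs = signsAtTop (qs.map (specialize ν)) := by
  rw [posLimit, signsAtTop, List.map_map]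
  refine List.map_congr_left fun q hq => ?_
  rcases eq_or_ne q 0 with rfl | hq0
  · simp
  · have hlead := (hqs q hq).resolve_left hq0
    rw [if_neg hq0, hlead.lookupSign_eq ha, Option.getD_some, Function.comp_apply,
      leadingCoeff_specialize (hlead.eval_ne_zero ha)]

theorem negLimit_eq_signsAtBot : negLimit a qs = signsAtBot (qs.map (specialize ν)) := by
  rw [negLimit, signsAtBot, List.map_map]
  refine List.map_congr_left fun q hq => ?_
  rcases eq_or_ne q 0 with rfl | hq0
  · simp
  · have hlead := (hqs q hq).resolve_left hq0
    rw [if_neg hq0, hlead.lookupSign_eq ha, Option.getD_some, Function.comp_apply,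
      leadingCoeff_specialize (hlead.eval_ne_zero ha),
      natDegree_specialize (hlead.eval_ne_zero ha)]

theorem specialize_polyP : specialize ν (polyP qs) =
    prodNonzero (qs.map (specialize ν)) * derivative (prodNonzero (qs.map (specialize ν))) := by
  have specialize_prod := map_prodNonzero (specialize ν) fun q hq h0 =>
    (hqs q hq).resolve_right fun h => specialize_ne_zero (h.eval_ne_zero ha) h0
  rw [polyP_eq_mul_derivative, map_mul, specialize_derivative, specialize_prod]

theorem natDegree_specialize_eq_zero_of_polyP (h : specialize ν (polyP qs) = 0) {q : RMPoly}
    (hq : q ∈ qs) : (specialize ν q).natDegree = 0 := by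
  rw [specialize_polyP ha hqs] at h
  rcases eq_or_ne (specialize ν q) 0 with hq0 | hq0
  · rw [hq0, natDegree_zero]
  · exact natDegree_eq_zero_of_mul_derivative_eq_zero (prodNonzero_ne_zero _) h
      (dvd_prodNonzero (List.mem_map_of_mem hq) hq0)

end Simplified

theorem isBranching_signDetermination (ν : List ℝ) (qs : List RMPoly) (a : Assumps) :
    IsBranching ν a (signDetermination qs a) fun _ L =>
      ∀ t, t ∈ L ↔ ∃ x, signsAt (qs.map (specialize ν)) x = t := by
  refine (isBranching_lcAssumpsList ν qs a).flatMap fun a' qs' _ hqs' => ?_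
  refine (isBranching_calculateData fun ha' h q hq =>
    natDegree_specialize_eq_zero_of_polyP ha' (hqs' ha').2 h hq).map
      (fun c => posLimit a' qs' :: negLimit a' qs' :: c.2.signs) ?_
  intro a'' E ha'' hcons hE t
  have ha' := hcons.mono ha''
  obtain ⟨map_eq, hlead⟩ := hqs' ha'
  rw [← map_eq, exists_signsAt_eq_iff, List.mem_cons, List.mem_cons, hE.mem_signs,
    specialize_polyP ha' hlead, posLimit_eq_signsAtTop ha' hlead, negLimit_eq_signsAtBot ha' hlead]

/-! ### Correctness of quantifier elimination -/

/-- Formulas without quantifiers, the only ones to which `elimForall` and `elimExist` apply. -/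
def QuantifierFree : Fm Atom → Prop
  | .trueF => True
  | .falseF => True
  | .atom _ => True
  | .and F G => QuantifierFree F ∧ QuantifierFree G
  | .or F G => QuantifierFree F ∧ QuantifierFree G
  | .neg F => QuantifierFree F
  | .exQ _ => False
  | .allQ _ => False
  | .exN _ _ => False
  | .allN _ _ => False

theorem quantifierFree_assumpsToFm : ∀ a : Assumps, QuantifierFree (assumpsToFm a)
  | [] => trivial
  | _ :: a => ⟨trivial, quantifierFree_assumpsToFm a⟩

theorem quantifierFree_disjunction : ∀ L : List Assumps, QuantifierFree (disjunction L)
  | [] => trivial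
  | a :: L => ⟨quantifierFree_assumpsToFm a, quantifierFree_disjunction L⟩

theorem quantifierFree_elimForall (F : Fm Atom) : QuantifierFree (elimForall F) :=
  quantifierFree_disjunction _

theorem quantifierFree_elimExist (F : Fm Atom) : QuantifierFree (elimExist F) :=
  quantifierFree_elimForall _

theorem quantifierFree_iterate {f : Fm Atom → Fm Atom} (hf : ∀ F, QuantifierFree (f F))
    {F : Fm Atom} (hF : QuantifierFree F) : ∀ n, QuantifierFree (f^[n] F)
  | 0 => hF
  | n + 1 => by
    rw [Function.iterate_succ_apply']
    exact hf _

theorem quantifierFree_qe : ∀ F : Fm Atom, QuantifierFree (qe F)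
  | .trueF => trivial
  | .falseF => trivial
  | .atom _ => trivial
  | .and F G => ⟨quantifierFree_qe F, quantifierFree_qe G⟩
  | .or F G => ⟨quantifierFree_qe F, quantifierFree_qe G⟩
  | .neg F => quantifierFree_qe F
  | .exQ F => quantifierFree_elimExist (qe F)
  | .allQ F => quantifierFree_elimForall (qe F)
  | .exN n F => quantifierFree_iterate quantifierFree_elimExist (quantifierFree_qe F) n
  | .allN n F => quantifierFree_iterate quantifierFree_elimForall (quantifierFree_qe F) n

theorem eval_specialize_univariateIn (x : ℝ) (ν : List ℝ) (p : RealMPoly) :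
    (specialize ν ((univariateIn 0 p).map lowerPoly.toRingHom)).eval x = evalMPoly (x :: ν) p := by
  have eq_evalHom : (evalRingHom x).comp ((specialize ν).comp
      ((mapRingHom lowerPoly.toRingHom).comp (MvPolynomial.aeval fun i =>
        if i = 0 then (X : RMPoly) else C (MvPolynomial.X i)).toRingHom)) = evalHom (x :: ν) := by
    refine MvPolynomial.ringHom_ext (fun r => ?_) fun i => ?_
    · have algebraMap_eq : algebraMap ℝ RMPoly r = C (MvPolynomial.C r) := rfl
      simp [specialize, evalHom, algebraMap_eq, lowerPoly]
    · cases i <;> simp [specialize, evalHom, lowerPoly]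
  exact RingHom.congr_fun eq_evalHom p

theorem signsAt_univariateIn (x : ℝ) (ν : List ℝ) (qs : List RealMPoly) :
    signsAt (((qs.map (univariateIn 0)).map (Polynomial.map lowerPoly.toRingHom)).map
      (specialize ν)) x = qs.map fun q => sgn (evalMPoly (x :: ν) q) := by
  simp only [signsAt, List.map_map, Function.comp_def, eval_specialize_univariateIn]

theorem lookupSign_zip_map (g : RealMPoly → ℚ) {c : RealMPoly} : ∀ {qs : List RealMPoly},
    c ∈ qs → lookupSign c (qs.zip (qs.map g)) = some (g c)
  | [], h => absurd h List.not_mem_nil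
  | q :: qs, h => by
    rw [List.map_cons, List.zip_cons_cons, lookupSign]
    split_ifs with hc
    · rw [hc]
    · exact lookupSign_zip_map g ((List.mem_cons.1 h).resolve_left hc)

theorem Atom.holdsAt_sgn (A : Atom) (μ : List ℝ) :
    A.holdsAt (sgn (evalMPoly μ A.poly)) ↔ aEval A μ := by
  cases A with
  | _ p =>
    simp only [Atom.holdsAt, aEval, Atom.poly]
    rcases sgn_cases (evalMPoly μ p) with ⟨h, sgn_eq⟩ | ⟨h, sgn_eq⟩ | ⟨h, sgn_eq⟩ <;> rw [sgn_eq]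
    · simp [h, h.le, h.ne]
    · simp [h]
    · simp [h.not_gt, h.not_ge, h.ne']

theorem lookupSem_eq {qs : List RealMPoly} {μ : List ℝ} : ∀ {F : Fm Atom}, QuantifierFree F →
    extractPolys F ⊆ qs →
    lookupSem F (qs.zip (qs.map fun p => sgn (evalMPoly μ p))) = some (eval F μ)
  | .trueF, _, _ => rfl
  | .falseF, _, _ => rfl
  | .atom A, _, h => by
    rw [lookupSem, lookupSign_zip_map _ (h (List.mem_singleton_self _)), Option.map_some, eval,
      Atom.holdsAt_sgn]
  | .and F G, hF, h => by
    rw [extractPolys, List.append_subset] at h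
    rw [lookupSem, lookupSem_eq hF.1 h.1, lookupSem_eq hF.2 h.2]
    rfl
  | .or F G, hF, h => by
    rw [extractPolys, List.append_subset] at h
    rw [lookupSem, lookupSem_eq hF.1 h.1, lookupSem_eq hF.2 h.2]
    rfl
  | .neg F, hF, h => by
    rw [lookupSem, lookupSem_eq (F := F) hF h]
    rfl

theorem aEval_assumpToAtom {ν : List ℝ} {c : RealMPoly} {s : ℚ} (hs : s = 0 ∨ s = 1 ∨ s = -1) :
    aEval (assumpToAtom (c, s)) ν ↔ s = sgn (evalMPoly ν c) := by
  have evalMPoly_neg : evalMPoly ν (-c) = -evalMPoly ν c := map_neg (evalHom ν) c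
  rcases hs with rfl | rfl | rfl <;>
    rcases sgn_cases (evalMPoly ν c) with ⟨h, sgn_eq⟩ | ⟨h, sgn_eq⟩ | ⟨h, sgn_eq⟩ <;>
    rw [sgn_eq] <;> norm_num [assumpToAtom, aEval, evalMPoly_neg] <;> linarith

theorem eval_assumpsToFm {ν : List ℝ} : ∀ {a : Assumps}, ProperSigns a →
    (eval (assumpsToFm a) ν ↔ Consistent ν a)
  | [], _ => by simp [assumpsToFm, eval, Consistent]
  | (c, s) :: a, h => by
    obtain ⟨hs, ha⟩ := properSigns_cons.1 h
    rw [assumpsToFm, eval, eval_assumpsToFm ha, consistent_cons]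
    exact and_congr_left' (aEval_assumpToAtom hs)

theorem eval_disjunction {ν : List ℝ} : ∀ L : List Assumps,
    eval (disjunction L) ν ↔ ∃ a ∈ L, eval (assumpsToFm a) ν
  | [] => by simp [disjunction, eval]
  | a :: L => by simp [disjunction, eval, eval_disjunction L]

theorem IsBranching.eval_disjunction_filter {β : Type*} {ν : List ℝ} {L : List (Assumps × β)}
    {P : β → Prop} [DecidablePred P] {R : Prop} (h : IsBranching ν [] L fun _ x => P x ↔ R) :
    eval (disjunction ((L.filter fun b => P b.2).map Prod.fst)) ν ↔ R := by
  have eval_iff : ∀ b ∈ L, eval (assumpsToFm b.1) ν ↔ Consistent ν b.1 := fun b hb =>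
    eval_assumpsToFm (h.proper b hb (List.forall_mem_nil _))
  simp only [eval_disjunction, List.mem_map, List.mem_filter, decide_eq_true_eq]
  constructor
  · rintro ⟨_, ⟨b, ⟨hb, hP⟩, rfl⟩, hcons⟩
    exact (h.correct b hb ((eval_iff b hb).1 hcons)).1 hP
  · intro hR
    obtain ⟨b, hb, hcons⟩ := h.exists_consistent (List.forall_mem_nil _)
    exact ⟨_, ⟨b, ⟨hb, (h.correct b hb hcons).2 hR⟩, rfl⟩, (eval_iff b hb).2 hcons⟩

theorem eval_elimForall {F : Fm Atom} (hF : QuantifierFree F) (ν : List ℝ) :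
    eval (elimForall F) ν ↔ ∀ x, eval F (x :: ν) := by
  classical
  refine IsBranching.eval_disjunction_filter
    (P := fun L => ∀ s ∈ L, ∃ P : Prop, lookupSem F ((extractPolys F).zip s) = some P ∧ P)
    ((isBranching_signDetermination ν _ []).imp fun _ L _ _ hL => ?_)
  simp only [hL, signsAt_univariateIn, forall_exists_index, forall_apply_eq_imp_iff,
    lookupSem_eq hF (List.Subset.refl _), Option.some.injEq, exists_eq_left']

theorem eval_elimExist {F : Fm Atom} (hF : QuantifierFree F) (ν : List ℝ) :
    eval (elimExist F) ν ↔ ∃ x, eval F (x :: ν) := by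
  rw [elimExist, eval, eval_elimForall (F := .neg F) hF]
  exact not_forall_not

theorem forall_length_eq_succ {α : Type*} {n : ℕ} {P : List α → Prop} :
    (∀ L, L.length = n + 1 → P L) ↔ ∀ L, L.length = n → ∀ x, P (x :: L) :=
  ⟨fun h L hL x => h (x :: L) (congrArg (· + 1) hL), fun h L hL => by
    obtain ⟨x, L, rfl⟩ := List.exists_cons_of_length_eq_add_one hL
    exact h L (Nat.succ.inj hL) x⟩

theorem eval_iterate_elimForall {F : Fm Atom} (hF : QuantifierFree F) (ν : List ℝ) (n : ℕ) :
    eval (elimForall^[n] F) ν ↔ ∀ L : List ℝ, L.length = n → eval F (L ++ ν) := by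
  induction n generalizing F with
  | zero => simp
  | succ n ih =>
    rw [Function.iterate_succ_apply, ih (quantifierFree_elimForall F), forall_length_eq_succ]
    simp only [eval_elimForall hF, List.cons_append]

theorem eval_iterate_elimExist {F : Fm Atom} (hF : QuantifierFree F) (ν : List ℝ) (n : ℕ) :
    eval (elimExist^[n] F) ν ↔ ∃ L : List ℝ, L.length = n ∧ eval F (L ++ ν) := by
  induction n generalizing F with
  | zero => simp
  | succ n ih =>
    rw [Function.iterate_succ_apply, ih (quantifierFree_elimExist F), ← not_iff_not]
    push Not
    rw [forall_length_eq_succ]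
    simp only [eval_elimExist hF, not_exists, List.cons_append]

end HybridQE

end

/-- Every formula of first-order real arithmetic has the same truth value as the output of the
quantifier elimination procedure, under every valuation of the free variables. -/
theorem mainTheorem1 (F : HybridQE.Fm HybridQE.Atom) (ν : List ℝ) :
    HybridQE.eval F ν ↔ HybridQE.eval (HybridQE.qe F) ν := by
  induction F generalizing ν with
  | trueF | falseF | atom => exact Iff.rfl
  | and F G hF hG => exact and_congr (hF ν) (hG ν)
  | or F G hF hG => exact or_congr (hF ν) (hG ν)
  | neg F hF => exact not_congr (hF ν)
  | exQ F hF =>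
    exact (exists_congr fun x => hF (x :: ν)).trans
      (HybridQE.eval_elimExist (HybridQE.quantifierFree_qe F) ν).symm
  | allQ F hF =>
    exact (forall_congr' fun x => hF (x :: ν)).trans
      (HybridQE.eval_elimForall (HybridQE.quantifierFree_qe F) ν).symm
  | exN n F hF =>
    exact (exists_congr fun L => and_congr_right' (hF (L ++ ν))).trans
      (HybridQE.eval_iterate_elimExist (HybridQE.quantifierFree_qe F) ν n).symm
  | allN n F hF =>
    exact (forall₂_congr fun L _ => hF (L ++ ν)).trans
      (HybridQE.eval_iterate_elimForall (HybridQE.quantifierFree_qe F) ν n).symm
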